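/- Let $n\ge 3$. Write $x=(x'',x_{n-1},x_n)\in\mathbb R^n$, $x'=(x'',x_{n-1})$, identify $\mathbb R^{n-1}$ with $\{x_n=0\}$, and put $B_r^+(x_0)=B_r(x_0)\cap\{x_n>0\}$, $B_r'(x_0)=B_r(x_0)\cap\{x_n=0\}$, $(\partial B_r(x_0))^+=\partial B_r(x_0)\cap\{x_n>0\}$, $B_r''=\{x''\in\mathbb R^{n-2}:|x''|<r\}$; the centre is omitted when it is $0$. Let $0<\alpha\le 1$. Let $u\in C^{1,1/2}_{loc}(B_2^+\cup B_2')$ solve the Signorini problem in $B_2^+$: $\Delta u=0$ in $B_2^+$, and $u\ge 0$, $-\partial_{x_n}u\ge 0$, $u\,\partial_{x_n}u=0$ on $B_2'$. Let $\Lambda_u=\{x\in B_2':u(x)=0\}$, $\Omega_u=\{x\in B_2':u(x)>0\}$, and let $\Gamma_u$ be the boundary of $\Omega_u$ relative to $B_2'$. Assume the following. (a) Every $x_0\in\Gamma_u$ is regular: $\displaystyle \lim_{r\to0+}\frac{r\int_{B_r^+(x_0)}|\nabla u|^2}{\int_{(\partial B_r(x_0))^+}u^2}=\frac32$. (b) There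 is $f\in C^{1,\alpha}(\overline{B_2''})$ with $f(0)=0$, $\nabla f(0)=0$, $\Gamma_u=\{x\in B_2':x_{n-1}=f(x'')\}$ and $\Lambda_u=\{x\in B_2':x_{n-1}\le f(x'')\}$. (c) $\partial_{x_{n-1}}u>0$ in $B_2^+\cup\Omega_u$, $\partial_{x_n}u<0$ in $B_2^+\cup(\Lambda_u\setminus\Gamma_u)$, and $\partial_{x_n}u=0$ on $\Omega_u\cup\Gamma_u$. (d) For every $\eta>0$ there are $r_\eta\in(0,1)$ and $c_\eta>0$ such that $\partial_\tau u(x)\ge c_\eta\, d(x,\Lambda_u)$ for all $x_0\in\Gamma_u\cap B_1'$, all $x\in\overline{B_{r_\eta}^+(x_0)}$ and all unit vectors $\tau\in\mathbb R^{n-1}$ with $\tau\cdot\nu'_{x_0}\ge\eta$, where $\nu'_{x_0}$ is the unit normal in $\mathbb R^{n-1}$ to $\Gamma_u$ at $x_0$, outward to $\Lambda_u$. For $x_0\in\Gamma_u\cap B_1'$, $0<r<1$ and $c_0>0$ define $$u_{x_0}(x)=\operatorname{Re}\big((x-x_0)'\cdot\nu'_{x_0}+i x_n\big)^{3/2},\qquad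 M_{x_0}(r,u,c_0)=\frac1{r^{n+2}}\int_{(\partial B_r(x_0))^+}(u-c_0u_{x_0})^2 .$$ Then: 1. For every $\rho<1$ there is a finite constant $C_u$ with $$\|u\|_{C^{1,1/2}(\overline{B_r^+(x_0)})}\le C_u\quad\text{for all } 0<r<1 \text{ and all } x_0\in\Gamma_u\cap B_\rho'.\qquad(*)$$ 2. Given $n,\alpha,c_0$, a bound $L\ge\|f\|_{C^{1,\alpha}(\overline{B_2''})}$ and a number $C_u$, there is a constant $\tilde C$ depending only on $n,\alpha,c_0,L,C_u$ such that for all $u,f$ as above and every $x_0\in\Gamma_u\cap B_1'$ at which the bound in $(*)$ holds for all $0<r<1$ with the constant $C_u$, the function $$r\mapsto M_{x_0}(r,u,c_0)+\tilde C r^\alpha$$ is monotone nondecreasing on $(0,1)$. -/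

import Mathlib

open Set Filter Topology MeasureTheory
open scoped NNReal ENNReal

noncomputable section

namespace Signorini

/-- The ambient space `ℝⁿ` with `n = m + 2`; a point is `x = (x'', x_{n-1}, x_n)` with
`x'' ∈ ℝ^m`. -/
abbrev Space (m : ℕ) : Type := EuclideanSpace ℝ (Fin (m + 2))

/-- The index of the coordinate `x_n`. -/
def idxN (m : ℕ) : Fin (m + 2) := Fin.last (m + 1)

/-- The index of the coordinate `x_{n-1}`. -/
def idxN1 (m : ℕ) : Fin (m + 2) := (Fin.last m).castSucc

/-- The projection `x ↦ x'' = (x_1, …, x_{n-2})`. -/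
def proj {m : ℕ} (x : Space m) : EuclideanSpace ℝ (Fin m) :=
  WithLp.toLp 2 (fun i : Fin m => x i.castSucc.castSucc)

/-- `B_r⁺(x₀) = B_r(x₀) ∩ {x_n > 0}`. -/
def halfBall {m : ℕ} (x₀ : Space m) (r : ℝ) : Set (Space m) :=
  {x | x ∈ Metric.ball x₀ r ∧ 0 < x (idxN m)}

/-- `B'_r(x₀) = B_r(x₀) ∩ {x_n = 0}`. -/
def flatBall {m : ℕ} (x₀ : Space m) (r : ℝ) : Set (Space m) :=
  {x | x ∈ Metric.ball x₀ r ∧ x (idxN m) = 0}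

/-- `B_2⁺ ∪ B'_2`, the set on which solutions are considered. -/
def dom (m : ℕ) : Set (Space m) := halfBall 0 2 ∪ flatBall 0 2

/-- The differential of `u` on `B_2⁺ ∪ B'_2`: the usual one in the open half ball `B_2⁺`, and the
one-sided one (from `x_n ≥ 0`) on `B'_2`. Thus `D u x e` is the directional derivative `∂_e u(x)`. -/
def D {m : ℕ} (u : Space m → ℝ) (x : Space m) : Space m →L[ℝ] ℝ := fderivWithin ℝ u (dom m) x

/-- The partial derivative `∂_{x_i} u`, one-sided on `B'_2`. -/
def pd {m : ℕ} (i : Fin (m + 2)) (u : Space m → ℝ) (x : Space m) : ℝ :=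
  D u x (EuclideanSpace.single i 1)

/-- The norm `‖g‖_{C^{1,α}(S)} = sup_S |g| + sup_S |∇g| + [∇g]_{α,S}` in `[0, ∞]`, for a `C¹` function
`g` on a set `S` of unique differentiability (below `S` is the closure of a ball or a half ball). -/
def c1HolderNorm {V : Type*} [NormedAddCommGroup V] [NormedSpace ℝ V]
    (α : ℝ≥0) (g : V → ℝ) (S : Set V) : ℝ≥0∞ :=
  (⨆ x ∈ S, ‖g x‖ₑ) + (⨆ x ∈ S, ‖fderivWithin ℝ g S x‖ₑ)
    + eHolderNorm α (S.domRestrict (fderivWithin ℝ g S))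

/-- `g ∈ C^{1,α}(S)`. -/
def MemC1Holder {V : Type*} [NormedAddCommGroup V] [NormedSpace ℝ V]
    (α : ℝ≥0) (g : V → ℝ) (S : Set V) : Prop :=
  ContDiffOn ℝ 1 g S ∧ c1HolderNorm α g S < ∞

/-- `u ∈ C^{1,1/2}_loc(B_2⁺ ∪ B'_2)`: `u` is `C^{1,1/2}` on each closed half ball of radius `r < 2`
(these exhaust `B_2⁺ ∪ B'_2`). -/
def IsC1HalfLoc {m : ℕ} (u : Space m → ℝ) : Prop :=
  ∀ r : ℝ, 0 < r → r < 2 → MemC1Holder (1 / 2) u (closure (halfBall 0 r))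

/-- The coincidence set `Λ_u = {x ∈ B'_2 : u(x) = 0}`. -/
def coincidenceSet {m : ℕ} (u : Space m → ℝ) : Set (Space m) := {x | x ∈ flatBall 0 2 ∧ u x = 0}

/-- The positivity set `Ω_u = {x ∈ B'_2 : u(x) > 0}`. -/
def positivitySet {m : ℕ} (u : Space m → ℝ) : Set (Space m) := {x | x ∈ flatBall 0 2 ∧ 0 < u x}

/-- The free boundary `Γ_u`: the boundary of `Ω_u` in the relative topology of `B'_2`. -/
def freeBoundary {m : ℕ} (u : Space m → ℝ) : Set (Space m) :=
  flatBall 0 2 ∩ closure (positivitySet u) ∩ closure (flatBall 0 2 \ positivitySet u)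

/-- `u` solves the Signorini problem in `B_2⁺`: it is harmonic in `B_2⁺` and satisfies the
complementarity conditions on `B'_2`. -/
structure IsSolution {m : ℕ} (u : Space m → ℝ) : Prop where
  harmonic : InnerProductSpace.HarmonicOnNhd u (halfBall 0 2)
  nonneg : ∀ x ∈ flatBall (0 : Space m) 2, 0 ≤ u x
  normal_nonneg : ∀ x ∈ flatBall (0 : Space m) 2, 0 ≤ -pd (idxN m) u x
  compl : ∀ x ∈ flatBall (0 : Space m) 2, u x * pd (idxN m) u x = 0

/-- The surface integral `∫_{(∂B_r(x₀))⁺} g`, with `(∂B_r(x₀))⁺ = ∂B_r(x₀) ∩ {x_n > 0}`, for a centre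
`x₀` on `{x_n = 0}` and `r > 0`. The measure `volume.toSphere` is the surface measure of the unit
sphere, and `r^(m+1) = r^(n-1)` is the scaling factor of the surface measure. -/
def hemiIntegral {m : ℕ} (x₀ : Space m) (r : ℝ) (g : Space m → ℝ) : ℝ :=
  r ^ (m + 1) *
    ∫ ω in {ω : Metric.sphere (0 : Space m) 1 | 0 < (ω : Space m) (idxN m)},
      g (x₀ + r • (ω : Space m)) ∂((volume : Measure (Space m)).toSphere)

/-- Almgren's frequency function `N_{x₀}(u, r)`. -/
def frequency {m : ℕ} (u : Space m → ℝ) (x₀ : Space m) (r : ℝ) : ℝ :=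
  (r * ∫ x in halfBall x₀ r, ‖gradient u x‖ ^ 2) / hemiIntegral x₀ r (fun x => u x ^ 2)

/-- The set `R_u` of regular free boundary points: `κ(x₀) = N_{x₀}(0+, u) = 3/2`. -/
def regularSet {m : ℕ} (u : Space m → ℝ) : Set (Space m) :=
  {x₀ | x₀ ∈ freeBoundary u ∧ Tendsto (frequency u x₀) (𝓝[>] 0) (𝓝 (3 / 2))}

/-- The unit normal `ν'_{x₀}` in `ℝ^{n-1} = {x_n = 0}` to the graph `{x_{n-1} = f(x'')}` at `x₀`, outward
to `{x_{n-1} ≤ f(x'')}`: `(-∇f(x₀''), 1, 0) / √(1 + |∇f(x₀'')|²)`. -/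
def outerNormal {m : ℕ} (f : EuclideanSpace ℝ (Fin m) → ℝ) (x₀ : Space m) : Space m :=
  (Real.sqrt (1 + ‖gradient f (proj x₀)‖ ^ 2))⁻¹ •
    WithLp.toLp 2 (Fin.snoc (α := fun _ => ℝ)
      (Fin.snoc (α := fun _ => ℝ) (fun i : Fin m => -gradient f (proj x₀) i) 1) 0)

/-- The cone `C'_η(e) = {τ ∈ ℝ^{n-1} : τ · e ≥ η |τ|}`, with `ℝ^{n-1} = {x_n = 0}`. -/
def cone {m : ℕ} (η : ℝ) (e : Space m) : Set (Space m) :=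
  {τ | τ (idxN m) = 0 ∧ η * ‖τ‖ ≤ inner ℝ τ e}

/-- The standing assumptions on a solution `u` of the Signorini problem in `B_2⁺` all of whose free
boundary points are regular, with free boundary the graph of the `C^{1,α}` function `f`. -/
structure StandingAssumptions {m : ℕ} (α : ℝ≥0) (u : Space m → ℝ)
    (f : EuclideanSpace ℝ (Fin m) → ℝ) : Prop where
  solution : IsSolution u
  all_regular : freeBoundary u = regularSet u
  f_mem : MemC1Holder α f (Metric.closedBall 0 2)
  f_zero : f 0 = 0
  grad_f_zero : gradient f 0 = 0
  freeBoundary_eq : freeBoundary u = {x | x ∈ flatBall 0 2 ∧ x (idxN1 m) = f (proj x)}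
  coincidence_eq : coincidenceSet u = {x | x ∈ flatBall 0 2 ∧ x (idxN1 m) ≤ f (proj x)}
  u_mem : IsC1HalfLoc u
  tangential_pos : ∀ x ∈ halfBall 0 2 ∪ positivitySet u, 0 < pd (idxN1 m) u x
  normal_neg : ∀ x ∈ halfBall 0 2 ∪ (coincidenceSet u \ freeBoundary u), pd (idxN m) u x < 0
  normal_zero : ∀ x ∈ positivitySet u ∪ freeBoundary u, pd (idxN m) u x = 0
  nondegenerate : ∀ η : ℝ, 0 < η → ∃ r c : ℝ, 0 < r ∧ r < 1 ∧ 0 < c ∧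
    ∀ x₀ ∈ freeBoundary u ∩ flatBall 0 1, ∀ x ∈ closure (halfBall x₀ r),
      ∀ τ ∈ cone η (outerNormal f x₀), ‖τ‖ = 1 →
        c * Metric.infDist x (coincidenceSet u) ≤ D u x τ

/-- The profile `x ↦ Re ((x - x₀)' · ν'_{x₀} + i x_n)^{3/2}` (principal branch) at `x₀`. -/
def profile {m : ℕ} (f : EuclideanSpace ℝ (Fin m) → ℝ) (x₀ x : Space m) : ℝ :=
  (((inner ℝ (x - x₀) (outerNormal f x₀) : ℝ) + (x (idxN m) : ℝ) * Complex.I : ℂ)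
    ^ (3 / 2 : ℂ)).re

/-- The Monneau functional `M_{x₀}(r, u, c₀)`; note `n + 2 = m + 4`. -/
def monneau {m : ℕ} (f : EuclideanSpace ℝ (Fin m) → ℝ) (x₀ : Space m) (r : ℝ)
    (u : Space m → ℝ) (c₀ : ℝ) : ℝ :=
  1 / r ^ (m + 4) * hemiIntegral x₀ r (fun x => (u x - c₀ * profile f x₀ x) ^ 2)

/-- `K` bounds the `C^{1,1/2}` norm of `u` on the closed half balls `closure B_r⁺(x₀)`, `0 < r < 1`. -/
def HalfBallBound {m : ℕ} (u : Space m → ℝ) (x₀ : Space m) (K : ℝ≥0) : Prop :=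
  ∀ r : ℝ, 0 < r → r < 1 → c1HolderNorm (1 / 2) u (closure (halfBall x₀ r)) ≤ K

end Signorini

end

/-! Put U(x) = u(x₀ + x), let U_r(x) = r^(-3/2) U(r x) be its 3/2-homogeneous rescaling, p the
profile with normal ν'_{x₀}, N the frequency, and W(r) = ∫_{B_1⁺} |∇U_r|² - (3/2) ∫_{(∂B_1)⁺} U_r²
the Weiss energy. By scaling, M(r) = ∫_{(∂B_1)⁺} (U_r - c₀ p)² (`monneau_eq`), and r ∂_r U_r =
x·∇U_r - (3/2) U_r. As x·∇p = (3/2) p, on the half sphere (r/2) M'(r) = ∫ U_r ∂_ν U_r - (3/2) ∫ U_r²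
+ c₀ ∫ (U_r ∂_ν p - p ∂_ν U_r). By Green's formulas the first two terms are at least W(r), because
U_r ∂_n U_r = 0 on the flat disc. The last integral equals the integral of U_r ∂_n p - p ∂_n U_r
over the flat disc, where -p ∂_n U_r ≥ 0. Two facts remain.

W ≥ 0: W is nondecreasing (`SigData.weiss_mono`), and it tends to 0 at 0 because W = (∫ U_r²)(N -
3/2) with U_r bounded and N → 3/2 (`StandingAssumptions.tendsto_weiss`).

U_r ∂_n p ≥ -κ r^α on the flat disc: ∂_n p vanishes where x·ν ≥ 0. Where x·ν < 0, regularity of f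
puts r x in the contact set or at height at most L r^(1+α) above it, and |∇U| ≤ C_u |x|^(1/2), so U
is of order r^(3/2+α) (`StandingAssumptions.transl_le_of_inner_neg`). Hence M' ≥ -C r^(α-1), which
the correction C̃ r^α absorbs (`exists_const_monotone`).

Up to the flat boundary u is only C¹. The divergence theorem is therefore proved as an inequality
for continuous fields by means of cutoffs (`exists_const_divergence`), and the monotonicity of W
compares two rescalings U_r and U_s instead of differentiating W.

The bound (*) holds because the half balls in question all lie in one closed half ball of radius 1 +
ρ < 2. -/

noncomputable section

namespace Signorini

variable {m : ℕ}

/-! ### Half balls, polar coordinates and compactly supported test functions -/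

/-- The divergence of a vector field. -/
def dvg (X : Space m → Space m) (x : Space m) : ℝ :=
  ∑ i, fderiv ℝ X x (EuclideanSpace.single i 1) i

/-- The open unit half sphere. -/
def hemi (m : ℕ) : Set (Metric.sphere (0 : Space m) 1) := {ω | 0 < (ω : Space m) (idxN m)}

/-- The closed half ball. -/
def closedHalf (m : ℕ) (r : ℝ) : Set (Space m) := {x | ‖x‖ ≤ r ∧ 0 ≤ x (idxN m)}

/-- The surface measure of the unit sphere. -/
abbrev sph (m : ℕ) : Measure (Metric.sphere (0 : Space m) 1) :=
  (volume : Measure (Space m)).toSphere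

theorem continuous_coord (i : Fin (m + 2)) : Continuous fun x : Space m => x i := by fun_prop

theorem measurableSet_hemi : MeasurableSet (hemi m) :=
  (isOpen_lt continuous_const ((continuous_coord (idxN m)).comp continuous_subtype_val)).measurableSet

theorem isOpen_halfBall (x₀ : Space m) (r : ℝ) : IsOpen (halfBall x₀ r) :=
  Metric.isOpen_ball.inter (isOpen_lt continuous_const (continuous_coord _))

theorem isCompact_closedHalf (r : ℝ) : IsCompact (closedHalf m r) := by
  have : closedHalf m r = Metric.closedBall 0 r ∩ {x | 0 ≤ x (idxN m)} := by
    ext x; simp [closedHalf]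
  rw [this]
  exact (isCompact_closedBall _ _).inter_right (isClosed_le continuous_const (continuous_coord _))

theorem halfBall_subset_closedHalf {r : ℝ} : halfBall (0 : Space m) r ⊆ closedHalf m r := by
  intro x hx
  exact ⟨by simpa using (mem_ball_zero_iff.1 hx.1).le, hx.2.le⟩

theorem smul_mem_closedHalf {r s : ℝ} (hs : 0 ≤ s) {x : Space m} (hx : x ∈ closedHalf m r) :
    s • x ∈ closedHalf m (s * r) := by
  refine ⟨?_, ?_⟩
  · rw [norm_smul, Real.norm_of_nonneg hs]; exact mul_le_mul_of_nonneg_left hx.1 hs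
  · simpa using mul_nonneg hs hx.2

theorem closedHalf_mono {r s : ℝ} (h : r ≤ s) : closedHalf m r ⊆ closedHalf m s :=
  fun _ hx => ⟨hx.1.trans h, hx.2⟩

theorem hemi_mem_closedHalf {ω : Metric.sphere (0 : Space m) 1} (hω : ω ∈ hemi m) :
    (ω : Space m) ∈ closedHalf m 1 :=
  ⟨by simp, le_of_lt hω⟩

/-- The polar homeomorphism preserves measure, and the origin that it omits is a null set. -/
theorem integrable_polar {g : Space m → ℝ} (hg : Integrable g) :
    Integrable (fun p : Metric.sphere (0 : Space m) 1 × Ioi (0 : ℝ) => g (p.2.1 • (p.1 : Space m)))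
      ((sph m).prod (Measure.volumeIoiPow (m + 1))) ∧
    ∫ x, g x = ∫ p : Metric.sphere (0 : Space m) 1 × Ioi (0 : ℝ), g (p.2.1 • (p.1 : Space m))
      ∂((sph m).prod (Measure.volumeIoiPow (m + 1))) := by
  have hd : Module.finrank ℝ (Space m) - 1 = m + 1 := by simp
  have hmp := (volume : Measure (Space m)).measurePreserving_homeomorphUnitSphereProd
  rw [hd] at hmp
  have key : ∀ x : ({0}ᶜ : Set (Space m)),
      g (((homeomorphUnitSphereProd (Space m)) x).2.1 •
        (((homeomorphUnitSphereProd (Space m)) x).1 : Space m)) = g x := by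
    intro x
    have hx : ‖(x : Space m)‖ ≠ 0 := norm_ne_zero_iff.2 x.2
    simp [smul_smul, hx]
  constructor
  · rw [← hmp.integrable_comp_emb (Homeomorph.measurableEmbedding _)]
    have : ((fun p : Metric.sphere (0 : Space m) 1 × Ioi (0 : ℝ) => g (p.2.1 • (p.1 : Space m))) ∘
        homeomorphUnitSphereProd (Space m)) = g ∘ Subtype.val := by
      funext x; exact key x
    rw [this, ← integrableOn_iff_comap_subtypeVal (measurableSet_singleton _).compl]
    exact hg.integrableOn
  · rw [← hmp.integral_comp (Homeomorph.measurableEmbedding _)]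
    rw [integral_congr_ae (Eventually.of_forall key),
      integral_subtype_comap (measurableSet_singleton _).compl fun x => g x,
      restrict_compl_singleton]

/-- Integration in polar coordinates. -/
theorem integral_polar {g : Space m → ℝ} (hg : Integrable g) :
    ∫ x, g x = ∫ s in Ioi (0 : ℝ), s ^ (m + 1) * ∫ ω, g (s • (ω : Space m)) ∂(sph m) := by
  obtain ⟨h1, h2⟩ := integrable_polar hg
  rw [h2, integral_prod_symm _ h1]
  simp only [Measure.volumeIoiPow, ENNReal.ofReal]
  rw [integral_withDensity_eq_integral_smul, integral_subtype_comap measurableSet_Ioi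
    fun a => Real.toNNReal (a ^ (m + 1)) • ∫ ω, g (a • (ω : Space m)) ∂(sph m)]
  · refine setIntegral_congr_fun measurableSet_Ioi fun x hx => ?_
    rw [NNReal.smul_def, Real.coe_toNNReal _ (pow_nonneg (le_of_lt hx) _), smul_eq_mul]
  · exact (measurable_subtype_coe.pow_const _).real_toNNReal

/-- Each summand is an integration by parts against the constant function 1. -/
theorem integral_dvg_eq_zero {Y : Space m → Space m} (hY : ContDiff ℝ 1 Y)
    (hc : HasCompactSupport Y) : ∫ x, dvg Y x = 0 := by
  have hcont : Continuous (fderiv ℝ Y) := hY.continuous_fderiv one_ne_zero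
  have hcs : HasCompactSupport (fderiv ℝ Y) := hc.fderiv ℝ
  have hint : ∀ i : Fin (m + 2), Integrable fun x => fderiv ℝ Y x (EuclideanSpace.single i 1) i := by
    intro i
    apply Continuous.integrable_of_hasCompactSupport
    · exact (continuous_coord i).comp (hcont.clm_apply continuous_const)
    · refine hcs.comp_left (g := fun T : Space m →L[ℝ] Space m => T (EuclideanSpace.single i 1) i) ?_
      simp
  unfold dvg
  rw [integral_finsetSum _ fun i _ => hint i]
  refine Finset.sum_eq_zero fun i _ => ?_
  have hfd : ∀ x, fderiv ℝ (fun x => Y x i) x (EuclideanSpace.single i 1)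
      = fderiv ℝ Y x (EuclideanSpace.single i 1) i := by
    intro x
    have h := ((EuclideanSpace.proj (𝕜 := ℝ) i).hasFDerivAt (x := Y x)).comp x
      (hY.differentiable one_ne_zero x).hasFDerivAt
    have h' : HasFDerivAt (fun x => Y x i) _ x := h
    rw [h'.fderiv]; simp
  have hYi : Integrable fun x => Y x i := by
    apply Continuous.integrable_of_hasCompactSupport
    · exact (continuous_coord i).comp hY.continuous
    · exact hc.comp_left (g := fun v : Space m => v i) rfl
  have := integral_mul_fderiv_eq_neg_fderiv_mul_of_integrable (μ := (volume : Measure (Space m)))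
    (f := fun _ => (1 : ℝ)) (g := fun x => Y x i) (v := EuclideanSpace.single i 1)
    (by simp) (by simpa [hfd] using hint i) (by simpa using hYi)
    (fun x _ => differentiableAt_const _)
    (fun x _ => ((EuclideanSpace.proj (𝕜 := ℝ) i).differentiableAt).comp x
      (hY.differentiable one_ne_zero x))
  simpa [hfd] using this

theorem dvg_smul {ψ : Space m → ℝ} {X : Space m → Space m} {x : Space m}
    (hψ : DifferentiableAt ℝ ψ x) (hX : DifferentiableAt ℝ X x) :
    dvg (fun y => ψ y • X y) x = ψ x * dvg X x + fderiv ℝ ψ x (X x) := by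
  unfold dvg
  have hf : HasFDerivAt (fun y => ψ y • X y) _ x := hψ.hasFDerivAt.smul hX.hasFDerivAt
  rw [hf.fderiv]
  have hx : fderiv ℝ ψ x (X x) = ∑ i, fderiv ℝ ψ x (EuclideanSpace.single i 1) * X x i := by
    conv_lhs => rw [← (EuclideanSpace.basisFun (Fin (m + 2)) ℝ).sum_repr (X x)]
    simp [map_sum, mul_comm]
  rw [hx, Finset.mul_sum, ← Finset.sum_add_distrib]
  refine Finset.sum_congr rfl fun i _ => ?_
  simp

/-- Testing the divergence with a compactly supported function. -/
theorem setIntegral_test_dvg {O : Set (Space m)} (hO : IsOpen O) {ψ : Space m → ℝ}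
    {X : Space m → Space m} (hψ : ContDiff ℝ 1 ψ) (hc : HasCompactSupport ψ) (hs : tsupport ψ ⊆ O)
    (hX : ContDiffOn ℝ 1 X O) :
    ∫ x in O, (ψ x * dvg X x + fderiv ℝ ψ x (X x)) = 0 := by
  have hXat : ∀ x ∈ O, ContDiffAt ℝ 1 X x := fun x hx => hX.contDiffAt (hO.mem_nhds hx)
  have hY : ContDiff ℝ 1 fun x => ψ x • X x := by
    refine contDiff_iff_contDiffAt.2 fun x => ?_
    by_cases hx : x ∈ tsupport fun x => ψ x • X x
    swap
    · exact (contDiffAt_const (c := (0 : Space m))).congr_of_eventuallyEq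
        (notMem_tsupport_iff_eventuallyEq.1 hx)
    have : x ∈ tsupport ψ := tsupport_smul_subset_left ψ X hx
    exact hψ.contDiffAt.smul (hXat x (hs this))
  have h0 := integral_dvg_eq_zero hY hc.smul_right
  rw [← h0, ← setIntegral_eq_integral_of_forall_compl_eq_zero (s := O)
    (f := fun x => dvg (fun x => ψ x • X x) x)]
  · refine setIntegral_congr_fun hO.measurableSet fun x hx => ?_
    exact (dvg_smul (hψ.differentiable one_ne_zero x)
      ((hXat x hx).differentiableAt one_ne_zero)).symm
  · intro x hx
    have hx' : x ∉ tsupport fun x => ψ x • X x := fun h => hx (hs (tsupport_smul_subset_left ψ X h))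
    have : fderiv ℝ (fun x => ψ x • X x) x = 0 := by
      by_contra hne
      exact hx' (support_fderiv_subset ℝ hne)
    simp [dvg, this]

/-! ### Cutoffs, and the divergence inequality near the flat boundary -/

/-- The strip sits in a box of side 2 in m + 1 directions and t in the last. The linear decay in t
compensates the factor k in the derivative of `flatCut`. -/
theorem volume_strip_le (t : ℝ) (ht : 0 ≤ t) :
    volume.real {x : Space m | x ∈ halfBall 0 1 ∧ x (idxN m) ≤ t} ≤ 2 ^ (m + 1) * t := by
  set s : Fin (m + 2) → Set ℝ := Fin.snoc (α := fun _ => Set ℝ) (fun _ => Icc (-1) 1) (Icc 0 t)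
  have hsub : {x : Space m | x ∈ halfBall 0 1 ∧ x (idxN m) ≤ t} ⊆
      (WithLp.ofLp : Space m → _) ⁻¹' (univ.pi s) := by
    rintro x ⟨⟨h1, h2⟩, h3⟩ i _
    have hn : ‖x‖ < 1 := mem_ball_zero_iff.1 h1
    refine Fin.lastCases ?_ (fun j => ?_) i
    · simp only [s, Fin.snoc_last]
      exact ⟨h2.le, h3⟩
    · simp only [s, Fin.snoc_castSucc]
      have := (PiLp.norm_apply_le x j.castSucc).trans hn.le
      exact abs_le.1 this
  have hvol : volume ((WithLp.ofLp : Space m → _) ⁻¹' (univ.pi s)) = ENNReal.ofReal (2 ^ (m + 1) * t) := by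
    rw [(PiLp.volume_preserving_ofLp (Fin (m + 2))).measure_preimage, volume_pi_pi]
    · rw [Fin.prod_univ_castSucc]
      simp [s, ENNReal.ofReal_mul]
      norm_num
    · refine (MeasurableSet.univ_pi fun i => ?_).nullMeasurableSet
      refine Fin.lastCases ?_ (fun j => ?_) i <;> simp [s]
  rw [measureReal_def]
  refine ENNReal.toReal_le_of_le_ofReal (by positivity) ?_
  rw [← hvol]
  exact measure_mono hsub

theorem deriv_smoothTransition_nonneg (t : ℝ) : 0 ≤ deriv Real.smoothTransition t :=
  Real.smoothTransition.monotone.deriv_nonneg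

theorem deriv_smoothTransition_of_neg {t : ℝ} (ht : t < 0) : deriv Real.smoothTransition t = 0 := by
  have : Real.smoothTransition =ᶠ[𝓝 t] fun _ => 0 := by
    filter_upwards [Iio_mem_nhds ht] with s hs
    exact Real.smoothTransition.zero_of_nonpos (le_of_lt hs)
  rw [this.deriv_eq, deriv_const]

theorem deriv_smoothTransition_of_one_lt {t : ℝ} (ht : 1 < t) :
    deriv Real.smoothTransition t = 0 := by
  have : Real.smoothTransition =ᶠ[𝓝 t] fun _ => 1 := by
    filter_upwards [Ioi_mem_nhds ht] with s hs
    exact Real.smoothTransition.one_of_one_le (le_of_lt hs)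
  rw [this.deriv_eq, deriv_const]

theorem continuous_deriv_smoothTransition : Continuous (deriv Real.smoothTransition) :=
  (Real.smoothTransition.contDiff (n := 1)).continuous_deriv le_rfl

theorem hasDerivAt_smoothTransition (t : ℝ) :
    HasDerivAt Real.smoothTransition (deriv Real.smoothTransition t) t :=
  ((Real.smoothTransition.contDiff (n := 1)).differentiable one_ne_zero t).hasDerivAt

theorem exists_deriv_smoothTransition_le :
    ∃ T : ℝ, 0 ≤ T ∧ ∀ t, deriv Real.smoothTransition t ≤ T := by
  obtain ⟨T, hT⟩ := (isCompact_Icc (a := (0 : ℝ)) (b := 1)).exists_bound_of_continuousOn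
    continuous_deriv_smoothTransition.continuousOn
  refine ⟨max T 0, le_max_right _ _, fun t => ?_⟩
  rcases lt_or_ge t 0 with h | h
  · rw [deriv_smoothTransition_of_neg h]; exact le_max_right _ _
  rcases lt_or_ge 1 t with h1 | h1
  · rw [deriv_smoothTransition_of_one_lt h1]; exact le_max_right _ _
  · exact (le_abs_self _).trans ((hT t ⟨h, h1⟩).trans (le_max_left _ _))

/-- A radial cutoff, supported in `‖x‖² ≤ 1 - 1 / j`. -/
def radCut (m : ℕ) (j : ℝ) (x : Space m) : ℝ := Real.smoothTransition (j * (1 - ‖x‖ ^ 2) - 1)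

/-- A cutoff near the hyperplane `x_n = 0`, supported in `1 / k ≤ x_n`. -/
def flatCut (m : ℕ) (k : ℝ) (x : Space m) : ℝ := Real.smoothTransition (k * x (idxN m) - 1)

/-- The radial peak functions. -/
def peak (j s : ℝ) : ℝ := 2 * j * s * deriv Real.smoothTransition (j * (1 - s ^ 2) - 1)

theorem hasFDerivAt_radCut (j : ℝ) (x : Space m) :
    HasFDerivAt (radCut m j)
      ((-2 * j * deriv Real.smoothTransition (j * (1 - ‖x‖ ^ 2) - 1)) • innerSL ℝ x) x := by
  have h1 : HasFDerivAt (fun y : Space m => j * (1 - ‖y‖ ^ 2) - 1)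
      (j • (0 - (2 : ℕ) • innerSL ℝ x)) x := by
    have := (hasStrictFDerivAt_norm_sq x).hasFDerivAt
    exact ((((hasFDerivAt_const (1 : ℝ) x).sub this).const_mul j).sub_const 1)
  have := (hasDerivAt_smoothTransition (j * (1 - ‖x‖ ^ 2) - 1)).comp_hasFDerivAt x h1
  refine this.congr_fderiv ?_
  ext v
  simp
  ring

theorem hasFDerivAt_flatCut (k : ℝ) (x : Space m) :
    HasFDerivAt (flatCut m k)
      ((k * deriv Real.smoothTransition (k * x (idxN m) - 1)) •
        (EuclideanSpace.proj (𝕜 := ℝ) (idxN m) : Space m →L[ℝ] ℝ)) x := by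
  have h1 : HasFDerivAt (fun y : Space m => k * y (idxN m) - 1)
      (k • (EuclideanSpace.proj (𝕜 := ℝ) (idxN m) : Space m →L[ℝ] ℝ)) x := by
    have : HasFDerivAt (fun y : Space m => y (idxN m)) _ x :=
      (EuclideanSpace.proj (𝕜 := ℝ) (idxN m) : Space m →L[ℝ] ℝ).hasFDerivAt
    exact (this.const_mul k).sub_const 1
  have := (hasDerivAt_smoothTransition (k * x (idxN m) - 1)).comp_hasFDerivAt x h1
  refine this.congr_fderiv ?_
  ext v
  simp
  ring

theorem contDiff_radCut (j : ℝ) : ContDiff ℝ 1 (radCut m j) :=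
  Real.smoothTransition.contDiff.comp
    ((contDiff_const.mul (contDiff_const.sub (contDiff_norm_sq ℝ))).sub contDiff_const)

theorem contDiff_flatCut (k : ℝ) : ContDiff ℝ 1 (flatCut m k) := by
  refine Real.smoothTransition.contDiff.comp ((contDiff_const.mul ?_).sub contDiff_const)
  exact (EuclideanSpace.proj (𝕜 := ℝ) (idxN m) : Space m →L[ℝ] ℝ).contDiff

theorem radCut_mem (j : ℝ) (x : Space m) : radCut m j x ∈ Icc (0 : ℝ) 1 :=
  ⟨Real.smoothTransition.nonneg _, Real.smoothTransition.le_one _⟩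

theorem flatCut_mem (j : ℝ) (x : Space m) : flatCut m j x ∈ Icc (0 : ℝ) 1 :=
  ⟨Real.smoothTransition.nonneg _, Real.smoothTransition.le_one _⟩

/-- The product of the two cutoffs has compact support in the open half ball, so nothing is asked of
X at the boundary. The terms carrying derivatives of the cutoffs become, in the limit, the fluxes
through the sphere and through the flat disc. -/
theorem test_half_ball {X : Space m → Space m} (hX : ContDiffOn ℝ 1 X (halfBall 0 1)) {j k : ℝ}
    (hj : 0 < j) (hk : 0 < k) :
    ∫ x in halfBall (0 : Space m) 1, (radCut m j x * flatCut m k x * dvg X x +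
      (flatCut m k x * (-2 * j * deriv Real.smoothTransition (j * (1 - ‖x‖ ^ 2) - 1) * inner ℝ x (X x))
      + radCut m j x * (k * deriv Real.smoothTransition (k * x (idxN m) - 1) * X x (idxN m)))) = 0 := by
  set K : Set (Space m) := {x | 0 ≤ j * (1 - ‖x‖ ^ 2) - 1 ∧ 0 ≤ k * x (idxN m) - 1}
  have hKc : IsClosed K := by
    have e1 : IsClosed {x : Space m | 0 ≤ j * (1 - ‖x‖ ^ 2) - 1} :=
      isClosed_le continuous_const (by fun_prop)
    have e2 : IsClosed {x : Space m | 0 ≤ k * x (idxN m) - 1} :=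
      isClosed_le continuous_const (by fun_prop)
    exact e1.inter e2
  have hKO : K ⊆ halfBall 0 1 := by
    rintro x ⟨h1, h2⟩
    refine ⟨?_, ?_⟩
    · rw [mem_ball_zero_iff]
      by_contra hc
      push Not at hc
      have : 1 ≤ ‖x‖ ^ 2 := by nlinarith
      nlinarith
    · by_contra hc
      push Not at hc
      nlinarith
  have hsupp : Function.support (fun x => radCut m j x * flatCut m k x) ⊆ K := by
    intro x hx
    rw [Function.mem_support] at hx
    refine ⟨?_, ?_⟩ <;> by_contra hc <;> push Not at hc <;> apply hx
    · simp [radCut, Real.smoothTransition.zero_of_nonpos hc.le]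
    · simp [flatCut, Real.smoothTransition.zero_of_nonpos hc.le]
  have hts : tsupport (fun x => radCut m j x * flatCut m k x) ⊆ K :=
    closure_minimal hsupp hKc
  have hcs : HasCompactSupport (fun x => radCut m j x * flatCut m k x) := by
    refine IsCompact.of_isClosed_subset (isCompact_closedBall (0 : Space m) 1)
      (isClosed_tsupport _) (hts.trans (hKO.trans ?_))
    exact fun x hx => Metric.ball_subset_closedBall hx.1
  have h0 := setIntegral_test_dvg (isOpen_halfBall 0 1)
    ((contDiff_radCut j).mul (contDiff_flatCut k)) hcs (hts.trans hKO) hX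
  rw [← h0]
  refine setIntegral_congr_fun (isOpen_halfBall _ _).measurableSet fun x _ => ?_
  have := (hasFDerivAt_radCut j x).mul (hasFDerivAt_flatCut k x)
  simp only
  rw [HasFDerivAt.fderiv (f := fun x => radCut m j x * flatCut m k x) this]
  simp
  ring

theorem finite_halfBall : volume (halfBall (0 : Space m) 1) ≠ ∞ :=
  ((measure_mono fun _ hx => hx.1).trans_lt measure_ball_lt_top).ne

theorem integrableOn_halfBall {g : Space m → ℝ} (hg : ContinuousOn g (halfBall 0 1)) {C : ℝ}
    (hC : ∀ x ∈ halfBall (0 : Space m) 1, |g x| ≤ C) : IntegrableOn g (halfBall 0 1) := by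
  have : IsFiniteMeasure (volume.restrict (halfBall (0 : Space m) 1)) :=
    ⟨by rw [Measure.restrict_apply_univ]; exact finite_halfBall.lt_top⟩
  refine Integrable.of_bound
    (hg.aestronglyMeasurable (isOpen_halfBall _ _).measurableSet) C ?_
  filter_upwards [ae_restrict_mem (isOpen_halfBall _ _).measurableSet] with x hx
  exact hC x hx

theorem continuousOn_dvg {X : Space m → Space m} {O : Set (Space m)} (hO : IsOpen O)
    (hX : ContDiffOn ℝ 1 X O) : ContinuousOn (dvg X) O := by
  unfold dvg
  have := hX.continuousOn_fderiv_of_isOpen hO le_rfl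
  refine continuousOn_finsetSum _ fun i _ => ?_
  exact (continuous_coord i).comp_continuousOn (this.clm_apply continuousOn_const)

/-- Near the flat boundary the normal component of a continuous field is almost bounded below by
its values on the flat boundary. -/
theorem exists_near_flat {X : Space m → Space m} (hX : ContinuousOn X (closedHalf m 1)) {κ : ℝ}
    (hκ : ∀ x ∈ closedHalf m 1, x (idxN m) = 0 → -κ ≤ X x (idxN m)) {ε : ℝ} (hε : 0 < ε) :
    ∃ δ > 0, ∀ x ∈ closedHalf m 1, x (idxN m) ≤ δ → -(κ + ε) ≤ X x (idxN m) := by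
  have huc := (isCompact_closedHalf (m := m) 1).uniformContinuousOn_of_continuous hX
  obtain ⟨δ, hδ, h⟩ := Metric.uniformContinuousOn_iff.1 huc ε hε
  refine ⟨δ / 2, half_pos hδ, fun x hx hxn => ?_⟩
  set y : Space m := x - EuclideanSpace.single (idxN m) (x (idxN m))
  have hyn : y (idxN m) = 0 := by simp [y]
  have hyx : ‖y‖ ≤ ‖x‖ := by
    rw [EuclideanSpace.norm_eq, EuclideanSpace.norm_eq]
    refine Real.sqrt_le_sqrt (Finset.sum_le_sum fun i _ => ?_)
    by_cases hi : i = idxN m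
    · subst hi; rw [hyn]; simp [sq_nonneg]
    · simp [y, hi]
  have hy : y ∈ closedHalf m 1 := ⟨hyx.trans hx.1, hyn.ge⟩
  have hd : dist x y < δ := by
    rw [dist_eq_norm]
    simp only [y, sub_sub_cancel, PiLp.norm_single, Real.norm_eq_abs, abs_of_nonneg hx.2]
    linarith
  have h2 := h x hx y hy hd
  have h3 : |X x (idxN m) - X y (idxN m)| ≤ dist (X x) (X y) := by
    rw [dist_eq_norm]
    simpa using PiLp.norm_apply_le (X x - X y) (idxN m)
  have := hκ y hy hyn
  have := neg_abs_le (X x (idxN m) - X y (idxN m))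
  linarith

/-- Removes the flat cutoff by letting k → ∞ with j fixed. Its derivative has mass bounded
independently of k and lives where x_n ≤ 2 / k, so the flat term costs at most κ times a dimensional
constant. The bound K serves only for dominated convergence and does not enter that constant. -/
theorem exists_const_radial_test (m : ℕ) : ∃ A : ℝ, 0 ≤ A ∧
    ∀ (X : Space m → Space m) (κ K j : ℝ), 0 ≤ κ → 0 < j → ContinuousOn X (closedHalf m 1) →
      ContDiffOn ℝ 1 X (halfBall 0 1) → (∀ x ∈ halfBall 0 1, |dvg X x| ≤ K) →
      (∀ x ∈ closedHalf m 1, x (idxN m) = 0 → -κ ≤ X x (idxN m)) →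
      (∫ x in halfBall (0 : Space m) 1, radCut m j x * dvg X x) +
        ∫ x in halfBall (0 : Space m) 1,
          -2 * j * deriv Real.smoothTransition (j * (1 - ‖x‖ ^ 2) - 1) * inner ℝ x (X x) ≤ κ * A := by
  obtain ⟨T, hT0, hT⟩ := exists_deriv_smoothTransition_le
  -- T bounds the slope of `Real.smoothTransition`; the constant is 2^(m+1) * (2 / k) * (k * T), the
  -- strip volume times the maximal density.
  refine ⟨T * 2 ^ (m + 2), by positivity, fun X κ K j hκ hj hXc hX hK hflat => ?_⟩
  set A := T * 2 ^ (m + 2)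
  have hA0 : 0 ≤ A := by positivity
  have hOm : MeasurableSet (halfBall (0 : Space m) 1) := (isOpen_halfBall _ _).measurableSet
  set R : Space m → ℝ := fun x =>
    -2 * j * deriv Real.smoothTransition (j * (1 - ‖x‖ ^ 2) - 1) * inner ℝ x (X x) with hR
  have hθ := continuous_deriv_smoothTransition
  have hRc : ContinuousOn R (closedHalf m 1) := by
    refine ContinuousOn.mul ?_ (continuousOn_id.inner hXc)
    fun_prop
  obtain ⟨C, hC⟩ := (isCompact_closedHalf (m := m) 1).exists_bound_of_continuousOn hRc
  have hdv := continuousOn_dvg (isOpen_halfBall _ _) hX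
  have hrc : Continuous (radCut m j) := (contDiff_radCut j).continuous
  have hfc : ∀ k, Continuous (flatCut m k) := fun k => (contDiff_flatCut k).continuous
  have hlim : ∀ x ∈ halfBall (0 : Space m) 1,
      Tendsto (fun k : ℕ => flatCut m k x) atTop (𝓝 1) := by
    intro x hx
    refine tendsto_const_nhds.congr' ?_
    have h1 : Tendsto (fun k : ℕ => (k : ℝ) * x (idxN m)) atTop atTop :=
      tendsto_natCast_atTop_atTop.atTop_mul_const hx.2
    filter_upwards [h1.eventually_ge_atTop 2] with k hk
    exact (Real.smoothTransition.one_of_one_le (by linarith)).symm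
  have hab : ∀ a b : ℝ, a ∈ Icc (0 : ℝ) 1 → |a * b| ≤ |b| := by
    intro a b ha
    rw [abs_mul, abs_of_nonneg ha.1]
    exact mul_le_of_le_one_left (abs_nonneg _) ha.2
  have hprod : ∀ a b : ℝ, a ∈ Icc (0 : ℝ) 1 → b ∈ Icc (0 : ℝ) 1 → a * b ∈ Icc (0 : ℝ) 1 :=
    fun a b ha hb => ⟨mul_nonneg ha.1 hb.1, mul_le_one₀ ha.2 hb.1 hb.2⟩
  have t1 : Tendsto (fun k : ℕ => ∫ x in halfBall (0 : Space m) 1,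
      radCut m j x * flatCut m k x * dvg X x) atTop
      (𝓝 (∫ x in halfBall (0 : Space m) 1, radCut m j x * dvg X x)) := by
    refine tendsto_integral_of_dominated_convergence (fun _ => K) (fun k => ?_)
      (integrableOn_const finite_halfBall) (fun k => ?_) ?_
    · exact (((hrc.mul (hfc k)).continuousOn).mul hdv).aestronglyMeasurable hOm
    · filter_upwards [ae_restrict_mem hOm] with x hx
      exact (hab _ _ (hprod _ _ (radCut_mem j x) (flatCut_mem k x))).trans (hK x hx)
    · filter_upwards [ae_restrict_mem hOm] with x hx
      simpa using ((hlim x hx).const_mul (radCut m j x)).mul_const (dvg X x)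
  have t2 : Tendsto (fun k : ℕ => ∫ x in halfBall (0 : Space m) 1, flatCut m k x * R x) atTop
      (𝓝 (∫ x in halfBall (0 : Space m) 1, R x)) := by
    refine tendsto_integral_of_dominated_convergence (fun _ => C) (fun k => ?_)
      (integrableOn_const finite_halfBall) (fun k => ?_) ?_
    · exact (((hfc k).continuousOn).mul
        (hRc.mono halfBall_subset_closedHalf)).aestronglyMeasurable hOm
    · filter_upwards [ae_restrict_mem hOm] with x hx
      exact (hab _ _ (flatCut_mem k x)).trans (hC x (halfBall_subset_closedHalf hx))
    · filter_upwards [ae_restrict_mem hOm] with x hx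
      simpa using (hlim x hx).mul_const (R x)
  have key : ∀ ε > 0, (∫ x in halfBall (0 : Space m) 1, radCut m j x * dvg X x) +
      ∫ x in halfBall (0 : Space m) 1, R x ≤ (κ + ε) * A := by
    intro ε hε
    obtain ⟨δ, hδ, hnear⟩ := exists_near_flat hXc hflat hε
    refine le_of_tendsto (t1.add t2) ?_
    have h1 : Tendsto (fun k : ℕ => (k : ℝ) * δ) atTop atTop :=
      tendsto_natCast_atTop_atTop.atTop_mul_const hδ
    filter_upwards [h1.eventually_ge_atTop 2, eventually_gt_atTop 0] with k hk hk0
    have hk0' : (0 : ℝ) < k := by exact_mod_cast hk0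
    have i1 : IntegrableOn (fun x => radCut m j x * flatCut m k x * dvg X x) (halfBall 0 1) :=
      integrableOn_halfBall (((hrc.mul (hfc k)).continuousOn).mul hdv) (C := K) fun x hx =>
        (hab _ _ (hprod _ _ (radCut_mem j x) (flatCut_mem k x))).trans (hK x hx)
    have i2 : IntegrableOn (fun x => flatCut m k x * R x) (halfBall 0 1) :=
      integrableOn_halfBall (((hfc k).continuousOn).mul (hRc.mono halfBall_subset_closedHalf))
        (C := C) fun x hx =>
        (hab _ _ (flatCut_mem k x)).trans (hC x (halfBall_subset_closedHalf hx))
    set Z : Space m → ℝ := fun x =>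
      radCut m j x * (k * deriv Real.smoothTransition (k * x (idxN m) - 1) * X x (idxN m))
    have hZc : ContinuousOn Z (closedHalf m 1) := by
      refine hrc.continuousOn.mul (ContinuousOn.mul ?_
        ((continuous_coord (idxN m)).comp_continuousOn hXc))
      fun_prop
    obtain ⟨CZ, hCZ⟩ := (isCompact_closedHalf (m := m) 1).exists_bound_of_continuousOn hZc
    have i3 : IntegrableOn Z (halfBall 0 1) :=
      integrableOn_halfBall (hZc.mono halfBall_subset_closedHalf) (C := CZ)
        fun x hx => hCZ x (halfBall_subset_closedHalf hx)
    have i4 : IntegrableOn (fun x => flatCut m k x * R x + Z x) (halfBall 0 1) := i2.add i3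
    have h0 : ∫ x in halfBall (0 : Space m) 1, (radCut m j x * flatCut m k x * dvg X x +
      (flatCut m k x * R x + Z x)) = 0 := test_half_ball hX hj hk0'
    rw [integral_add i1 i4] at h0
    have h0' : ∫ x in halfBall (0 : Space m) 1, (flatCut m k x * R x + Z x) =
      (∫ x in halfBall (0 : Space m) 1, flatCut m k x * R x) + ∫ x in halfBall (0 : Space m) 1, Z x :=
      integral_add i2 i3
    rw [h0'] at h0
    set S : Set (Space m) := {x | x (idxN m) ≤ 2 / k}
    have hSm : MeasurableSet S := (isClosed_le (continuous_coord _) continuous_const).measurableSet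
    -- Once 2 / k ≤ δ, the normal component exceeds -(κ + ε) wherever the derivative of the flat
    -- cutoff is nonzero.
    have hlow : ∫ x in halfBall (0 : Space m) 1, S.indicator (fun _ => -((κ + ε) * (k * T))) x ≤
        ∫ x in halfBall (0 : Space m) 1, Z x := by
      refine setIntegral_mono_on ?_ i3 hOm fun x hx => ?_
      · exact (integrableOn_const finite_halfBall).indicator hSm
      · by_cases hxS : x ∈ S
        · rw [indicator_of_mem hxS]
          have hle : x (idxN m) ≤ δ := by
            refine le_trans hxS ?_
            rw [div_le_iff₀ hk0']; linarith
          have h3 := hnear x (halfBall_subset_closedHalf hx) hle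
          have h4 := deriv_smoothTransition_nonneg (k * x (idxN m) - 1)
          have h5 := hT (k * x (idxN m) - 1)
          have h6 := radCut_mem j x
          set d := deriv Real.smoothTransition (k * x (idxN m) - 1)
          have h7 : radCut m j x * (k * d) ≤ k * T := by
            calc radCut m j x * (k * d) ≤ 1 * (k * d) :=
                  mul_le_mul_of_nonneg_right h6.2 (by positivity)
              _ ≤ k * T := by rw [one_mul]; exact mul_le_mul_of_nonneg_left h5 hk0'.le
          have h8 : 0 ≤ radCut m j x * (k * d) := mul_nonneg h6.1 (by positivity)
          have h9 : Z x = (radCut m j x * (k * d)) * X x (idxN m) := by simp only [Z, d]; ring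
          rw [h9]
          have : 0 ≤ κ + ε := by linarith
          nlinarith
        · rw [indicator_of_notMem hxS]
          have : 1 < k * x (idxN m) - 1 := by
            have : 2 / k < x (idxN m) := not_le.1 hxS
            rw [div_lt_iff₀ hk0'] at this
            linarith
          simp [Z, deriv_smoothTransition_of_one_lt this]
    rw [integral_indicator hSm, Measure.restrict_restrict hSm, setIntegral_const] at hlow
    have hvol : volume.real (S ∩ halfBall (0 : Space m) 1) ≤ 2 ^ (m + 1) * (2 / k) := by
      refine le_trans (le_of_eq ?_) (volume_strip_le (m := m) (2 / k) (by positivity))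
      congr 1
      ext x; simp [S, and_comm]
    have h10 : volume.real (S ∩ halfBall (0 : Space m) 1) * (k * T) ≤ A := by
      calc _ ≤ 2 ^ (m + 1) * (2 / k) * (k * T) := mul_le_mul_of_nonneg_right hvol (by positivity)
        _ = A := by simp only [A]; field_simp; ring
    have h11 : (κ + ε) * (volume.real (S ∩ halfBall (0 : Space m) 1) * (k * T)) ≤ (κ + ε) * A :=
      mul_le_mul_of_nonneg_left h10 (by linarith)
    rw [smul_eq_mul] at hlow
    linarith
  refine le_of_forall_pos_le_add fun ε hε => ?_
  have h := key (ε / (A + 1)) (by positivity)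
  have : ε / (A + 1) * A ≤ ε := by
    rw [div_mul_eq_mul_div, div_le_iff₀ (by positivity)]
    nlinarith
  linarith

/-! ### Removing the radial cutoff: the divergence theorem on the half ball -/

theorem continuous_peak (j : ℝ) : Continuous (peak j) := by
  have := continuous_deriv_smoothTransition
  unfold peak
  fun_prop

theorem peak_nonneg {j s : ℝ} (hj : 0 ≤ j) (hs : 0 ≤ s) : 0 ≤ peak j s :=
  mul_nonneg (by positivity) (deriv_smoothTransition_nonneg _)

/-- The peak is the derivative of -θ(j(1 - s²) - 1), θ the smooth step. At s = 0 the argument is j -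
1 ≥ 1, at s = 1 it is -1, so the total variation is exactly one. -/
theorem integral_peak {j : ℝ} (hj : 2 ≤ j) : ∫ s in Ioo (0 : ℝ) 1, peak j s = 1 := by
  rw [← integral_Ioc_eq_integral_Ioo, ← intervalIntegral.integral_of_le zero_le_one]
  have hd : ∀ s ∈ uIcc (0 : ℝ) 1,
      HasDerivAt (fun s => -Real.smoothTransition (j * (1 - s ^ 2) - 1)) (peak j s) s := by
    intro s _
    have h1 : HasDerivAt (fun s : ℝ => j * (1 - s ^ 2) - 1) (j * (-(2 * s))) s := by
      have := (((hasDerivAt_pow 2 s).const_sub 1).const_mul j).sub_const 1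
      simpa using this
    have := ((hasDerivAt_smoothTransition (j * (1 - s ^ 2) - 1)).comp s h1).neg
    refine this.congr_deriv ?_
    simp only [peak]; ring
  rw [intervalIntegral.integral_eq_sub_of_hasDerivAt hd ((continuous_peak j).intervalIntegrable _ _)]
  rw [Real.smoothTransition.zero_of_nonpos (by norm_num),
    Real.smoothTransition.one_of_one_le (by linarith)]
  norm_num

/-- The peaks are nonnegative, of mass one, and vanish for s ≤ 1 - δ as soon as j δ > 2: an
approximate identity at the endpoint 1. -/
theorem tendsto_integral_peak {J : ℝ → ℝ} (hJ : ContinuousOn J (Icc 0 1)) :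
    Tendsto (fun j : ℕ => ∫ s in Ioo (0 : ℝ) 1, peak j s * J s) atTop (𝓝 (J 1)) := by
  have := tendsto_setIntegral_peak_smul_of_integrableOn_of_tendsto (μ := volume) (l := atTop)
    (φ := fun j : ℕ => peak j) (g := J) (x₀ := 1) (a := J 1) (s := Ioo (0 : ℝ) 1) (t := Ioo 0 1)
    measurableSet_Ioo measurableSet_Ioo Subset.rfl self_mem_nhdsWithin (by simp) ?_ ?_ ?_ ?_ ?_ ?_
  · simpa using this
  · exact Eventually.of_forall fun j s hs => peak_nonneg j.cast_nonneg hs.1.le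
  · intro u hu h1u
    obtain ⟨δ, hδ, hb⟩ := Metric.isOpen_iff.1 hu 1 h1u
    rw [Metric.tendstoUniformlyOn_iff]
    intro ε hε
    have h1 : Tendsto (fun k : ℕ => (k : ℝ) * δ) atTop atTop :=
      tendsto_natCast_atTop_atTop.atTop_mul_const hδ
    filter_upwards [h1.eventually_gt_atTop 2] with k hk s hs
    have hs1 : s ≤ 1 - δ := by
      by_contra hc
      push Not at hc
      refine hs.2 (hb ?_)
      rw [Metric.mem_ball, Real.dist_eq, abs_lt]
      constructor <;> linarith [hs.1.2]
    have hs0 := hs.1.1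
    have h2 : δ ≤ 1 - s ^ 2 := by nlinarith [hs.1.2]
    have h3 : (k : ℝ) * δ ≤ k * (1 - s ^ 2) := mul_le_mul_of_nonneg_left h2 k.cast_nonneg
    have : peak k s = 0 := by
      simp [peak, deriv_smoothTransition_of_one_lt (show 1 < k * (1 - s ^ 2) - 1 by linarith)]
    simpa [this] using hε
  · refine tendsto_const_nhds.congr' ?_
    filter_upwards [eventually_ge_atTop 2] with j hj
    exact (integral_peak (by exact_mod_cast hj)).symm
  · exact Eventually.of_forall fun j => (continuous_peak j).aestronglyMeasurable
  · exact (hJ.integrableOn_compact isCompact_Icc).mono_set Ioo_subset_Icc_self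
  · exact (hJ 1 (right_mem_Icc.2 zero_le_one)).mono Ioo_subset_Icc_self

theorem aestronglyMeasurable_hemi {h : Metric.sphere (0 : Space m) 1 → ℝ}
    (hh : ContinuousOn h (hemi m)) : AEStronglyMeasurable h ((sph m).restrict (hemi m)) :=
  hh.aestronglyMeasurable measurableSet_hemi

theorem integrableOn_hemi {h : Metric.sphere (0 : Space m) 1 → ℝ}
    (hh : ContinuousOn h (hemi m)) {C : ℝ} (hC : ∀ ω ∈ hemi m, |h ω| ≤ C) :
    IntegrableOn h (hemi m) (sph m) := by
  refine Integrable.of_bound (aestronglyMeasurable_hemi hh) C ?_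
  filter_upwards [ae_restrict_mem measurableSet_hemi] with x hx
  exact hC x hx

theorem mapsTo_hemi {s r : ℝ} (hs : 0 ≤ s) (hsr : s ≤ r) :
    MapsTo (fun ω : Metric.sphere (0 : Space m) 1 => s • (ω : Space m)) (hemi m)
      (closedHalf m r) := fun ω hω => by
  have := smul_mem_closedHalf hs (hemi_mem_closedHalf hω)
  rw [mul_one] at this
  exact closedHalf_mono hsr this

/-- The flux of a field through the half sphere of radius `s`. -/
def flux (X : Space m → Space m) (s : ℝ) : ℝ :=
  ∫ ω in hemi m, inner ℝ (ω : Space m) (X (s • (ω : Space m))) ∂(sph m)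

theorem continuousOn_flux {X : Space m → Space m} (hX : ContinuousOn X (closedHalf m 1)) :
    ContinuousOn (flux X) (Icc 0 1) := by
  obtain ⟨B, hB⟩ := (isCompact_closedHalf (m := m) 1).exists_bound_of_continuousOn hX
  refine continuousOn_of_dominated (bound := fun _ => B) (fun s hs => ?_) (fun s hs => ?_)
    (integrable_const _) ?_
  · refine aestronglyMeasurable_hemi (continuous_subtype_val.continuousOn.inner ?_)
    exact hX.comp (by fun_prop) (mapsTo_hemi hs.1 hs.2)
  · filter_upwards [ae_restrict_mem measurableSet_hemi] with ω hω
    refine (norm_inner_le_norm _ _).trans ?_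
    simpa using hB _ (mapsTo_hemi hs.1 hs.2 hω)
  · filter_upwards [ae_restrict_mem measurableSet_hemi] with ω hω
    refine continuousOn_const.inner (hX.comp (by fun_prop) fun s hs => mapsTo_hemi hs.1 hs.2 hω)

/-- The derivative of the radial cutoff depends on the norm only, so in polar coordinates this term
is an average of fluxes through half spheres, weighted by the peak. -/
theorem integral_radial_test {X : Space m → Space m} (hX : ContinuousOn X (closedHalf m 1)) (j : ℝ) :
    ∫ x in halfBall (0 : Space m) 1,
          -2 * j * deriv Real.smoothTransition (j * (1 - ‖x‖ ^ 2) - 1) * inner ℝ x (X x) =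
      -∫ s in Ioo (0 : ℝ) 1, peak j s * (s ^ (m + 1) * flux X s) := by
  set R : Space m → ℝ := fun x =>
    -2 * j * deriv Real.smoothTransition (j * (1 - ‖x‖ ^ 2) - 1) * inner ℝ x (X x) with hR
  have hOm : MeasurableSet (halfBall (0 : Space m) 1) := (isOpen_halfBall _ _).measurableSet
  have hθ := continuous_deriv_smoothTransition
  have hRc : ContinuousOn R (closedHalf m 1) := by
    refine ContinuousOn.mul ?_ (continuousOn_id.inner hX)
    fun_prop
  obtain ⟨C, hC⟩ := (isCompact_closedHalf (m := m) 1).exists_bound_of_continuousOn hRc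
  have hint : IntegrableOn R (halfBall 0 1) :=
    integrableOn_halfBall (hRc.mono halfBall_subset_closedHalf) (C := C)
      fun x hx => hC x (halfBall_subset_closedHalf hx)
  rw [← integral_indicator hOm, integral_polar (hint.integrable_indicator hOm), ← integral_neg,
    ← integral_indicator measurableSet_Ioi, ← integral_indicator measurableSet_Ioo]
  congr 1
  funext s
  by_cases hs0 : s ∈ Ioi (0 : ℝ)
  swap
  · rw [indicator_of_notMem hs0, indicator_of_notMem (fun h => hs0 h.1)]
  rw [indicator_of_mem hs0]
  have hs0' : 0 < s := hs0
  by_cases hs1 : s < 1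
  · rw [indicator_of_mem (show s ∈ Ioo (0 : ℝ) 1 from ⟨hs0, hs1⟩)]
    have : ∀ ω : Metric.sphere (0 : Space m) 1,
        (halfBall (0 : Space m) 1).indicator R (s • (ω : Space m)) =
        (hemi m).indicator (fun ω => -(peak j s) *
          inner ℝ (ω : Space m) (X (s • (ω : Space m)))) ω := by
      intro ω
      have hn : ‖s • (ω : Space m)‖ = s := by simp [norm_smul, abs_of_pos hs0']
      by_cases hω : ω ∈ hemi m
      · rw [indicator_of_mem hω, indicator_of_mem]
        · simp only [hR, hn, peak, inner_smul_left]
          simp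
          ring
        · refine ⟨by rw [mem_ball_zero_iff, hn]; exact hs1, ?_⟩
          simpa using mul_pos hs0' hω
      · rw [indicator_of_notMem hω, indicator_of_notMem]
        intro h
        have h2 : 0 < s * (ω : Space m) (idxN m) := by simpa using h.2
        exact hω (pos_of_mul_pos_right h2 hs0'.le)
    simp_rw [this]
    rw [integral_indicator measurableSet_hemi, integral_const_mul]
    simp only [flux]
    ring
  · rw [indicator_of_notMem (fun h => hs1 h.2)]
    have : ∀ ω : Metric.sphere (0 : Space m) 1,
        (halfBall (0 : Space m) 1).indicator R (s • (ω : Space m)) = 0 := by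
      intro ω
      refine indicator_of_notMem (fun h => hs1 ?_) _
      have := mem_ball_zero_iff.1 h.1
      simpa [norm_smul, abs_of_pos hs0'] using this
    simp [this]

/-- The divergence theorem on the unit half ball, as an inequality, for fields that are only
continuous up to the boundary and whose normal component on the flat boundary is bounded below. -/
theorem exists_const_divergence (m : ℕ) : ∃ A : ℝ, 0 ≤ A ∧
    ∀ (X : Space m → Space m) (κ K : ℝ), 0 ≤ κ → ContinuousOn X (closedHalf m 1) →
      ContDiffOn ℝ 1 X (halfBall 0 1) → (∀ x ∈ halfBall 0 1, |dvg X x| ≤ K) →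
      (∀ x ∈ closedHalf m 1, x (idxN m) = 0 → -κ ≤ X x (idxN m)) →
      ∫ x in halfBall (0 : Space m) 1, dvg X x ≤
        (∫ ω in hemi m, inner ℝ (ω : Space m) (X ω) ∂(sph m)) + κ * A := by
  obtain ⟨A, hA0, hA⟩ := exists_const_radial_test m
  refine ⟨A, hA0, fun X κ K hκ hXc hX hK hflat => ?_⟩
  have hOm : MeasurableSet (halfBall (0 : Space m) 1) := (isOpen_halfBall _ _).measurableSet
  have t1 : Tendsto (fun j : ℕ => ∫ x in halfBall (0 : Space m) 1, radCut m j x * dvg X x) atTop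
      (𝓝 (∫ x in halfBall (0 : Space m) 1, dvg X x)) := by
    refine tendsto_integral_of_dominated_convergence (fun _ => K) (fun k => ?_)
      (integrableOn_const finite_halfBall) (fun k => ?_) ?_
    · exact ((contDiff_radCut _).continuous.continuousOn.mul
        (continuousOn_dvg (isOpen_halfBall _ _) hX)).aestronglyMeasurable hOm
    · filter_upwards [ae_restrict_mem hOm] with x hx
      rw [norm_mul, Real.norm_of_nonneg (radCut_mem _ x).1]
      exact (mul_le_of_le_one_left (norm_nonneg _) (radCut_mem _ x).2).trans (hK x hx)
    · filter_upwards [ae_restrict_mem hOm] with x hx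
      have hx1 : ‖x‖ < 1 := mem_ball_zero_iff.1 hx.1
      have h0 : 0 < 1 - ‖x‖ ^ 2 := by nlinarith [norm_nonneg x]
      have h1 : Tendsto (fun k : ℕ => (k : ℝ) * (1 - ‖x‖ ^ 2)) atTop atTop :=
        tendsto_natCast_atTop_atTop.atTop_mul_const h0
      refine tendsto_const_nhds.congr' ?_
      filter_upwards [h1.eventually_ge_atTop 2] with k hk
      rw [radCut, Real.smoothTransition.one_of_one_le (by linarith), one_mul]
  have t2 := (tendsto_integral_peak (J := fun s => s ^ (m + 1) * flux X s)
    ((continuousOn_id.pow _).mul (continuousOn_flux hXc))).neg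
  have h1 : (1 : ℝ) ^ (m + 1) * flux X 1 =
    ∫ ω in hemi m, inner ℝ (ω : Space m) (X ω) ∂(sph m) := by simp [flux]
  rw [h1] at t2
  have := le_of_tendsto (t1.add t2) (b := κ * A) (by
    filter_upwards [eventually_gt_atTop 0] with j hj
    have := hA X κ K j hκ (by exact_mod_cast hj) hXc hX hK hflat
    rwa [integral_radial_test hXc] at this)
  linarith

/-! ### Green's formulas, as inequalities, for harmonic functions that are C¹ up to the boundary -/

/-- A harmonic function `a` in the unit half ball with gradient `A`, both continuous up to the
boundary. -/
structure HarmPair (a : Space m → ℝ) (A : Space m → Space m) : Prop where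
  cont : ContinuousOn a (closedHalf m 1)
  contGrad : ContinuousOn A (closedHalf m 1)
  hasGrad : ∀ x ∈ halfBall (0 : Space m) 1, HasFDerivAt a (innerSL ℝ (A x)) x
  c1 : ContDiffOn ℝ 1 A (halfBall 0 1)
  div_zero : ∀ x ∈ halfBall (0 : Space m) 1, dvg A x = 0

theorem dvg_add {X Y : Space m → Space m} {x : Space m} (hX : DifferentiableAt ℝ X x)
    (hY : DifferentiableAt ℝ Y x) : dvg (fun y => X y + Y y) x = dvg X x + dvg Y x := by
  have h : HasFDerivAt (fun y => X y + Y y) _ x := hX.hasFDerivAt.add hY.hasFDerivAt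
  simp only [dvg, h.fderiv, ← Finset.sum_add_distrib]
  simp

theorem dvg_const_smul {X : Space m → Space m} {x : Space m} (hX : DifferentiableAt ℝ X x) (c : ℝ) :
    dvg (fun y => c • X y) x = c * dvg X x := by
  rw [dvg_smul (ψ := fun _ => c) (differentiableAt_const c) hX]
  simp

namespace HarmPair

variable {a b : Space m → ℝ} {A B : Space m → Space m}

theorem diffAt (h : HarmPair a A) {x : Space m} (hx : x ∈ halfBall (0 : Space m) 1) :
    DifferentiableAt ℝ A x :=
  (h.c1.contDiffAt ((isOpen_halfBall _ _).mem_nhds hx)).differentiableAt one_ne_zero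

theorem add (h : HarmPair a A) (h' : HarmPair b B) :
    HarmPair (fun x => a x + b x) (fun x => A x + B x) where
  cont := h.cont.add h'.cont
  contGrad := h.contGrad.add h'.contGrad
  hasGrad x hx := by rw [map_add]; exact (h.hasGrad x hx).add (h'.hasGrad x hx)
  c1 := h.c1.add h'.c1
  div_zero x hx := by
    rw [dvg_add (h.diffAt hx) (h'.diffAt hx), h.div_zero x hx, h'.div_zero x hx, add_zero]

theorem const_mul (h : HarmPair a A) (c : ℝ) :
    HarmPair (fun x => c * a x) (fun x => c • A x) where
  cont := continuousOn_const.mul h.cont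
  contGrad := h.contGrad.const_smul c
  hasGrad x hx := by
    rw [map_smul]; exact (h.hasGrad x hx).const_mul c
  c1 := h.c1.const_smul c
  div_zero x hx := by rw [dvg_const_smul (h.diffAt hx), h.div_zero x hx, mul_zero]

theorem contDiffOn (h : HarmPair a A) : ContDiffOn ℝ 1 a (halfBall 0 1) := by
  rw [show (1 : WithTop ℕ∞) = 0 + 1 from (zero_add 1).symm,
    contDiffOn_succ_iff_fderiv_of_isOpen (isOpen_halfBall _ _)]
  refine ⟨fun x hx => (h.hasGrad x hx).differentiableAt.differentiableWithinAt, by simp, ?_⟩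
  rw [contDiffOn_zero]
  refine ((innerSL ℝ).continuous.comp_continuousOn h.c1.continuousOn).congr fun x hx => ?_
  exact (h.hasGrad x hx).fderiv

theorem dvg_smul (h : HarmPair a A) (h' : HarmPair b B) {x : Space m}
    (hx : x ∈ halfBall (0 : Space m) 1) : dvg (fun y => a y • B y) x = inner ℝ (A x) (B x) := by
  rw [Signorini.dvg_smul (h.hasGrad x hx).differentiableAt (h'.diffAt hx), h'.div_zero x hx,
    (h.hasGrad x hx).fderiv]
  simp

end HarmPair

/-- A continuous function on the closed half ball is integrable on the half sphere. -/
theorem integrableOn_hemi_of_continuousOn {h : Space m → ℝ} (hh : ContinuousOn h (closedHalf m 1)) :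
    IntegrableOn (fun ω : Metric.sphere (0 : Space m) 1 => h ω) (hemi m) (sph m) := by
  obtain ⟨C, hC⟩ := (isCompact_closedHalf (m := m) 1).exists_bound_of_continuousOn hh
  exact integrableOn_hemi (hh.comp continuous_subtype_val.continuousOn
    fun _ hω => hemi_mem_closedHalf hω) (C := C) fun ω hω => hC _ (hemi_mem_closedHalf hω)

theorem integrableOn_halfBall_of_continuousOn {h : Space m → ℝ}
    (hh : ContinuousOn h (closedHalf m 1)) : IntegrableOn h (halfBall 0 1) := by
  obtain ⟨C, hC⟩ := (isCompact_closedHalf (m := m) 1).exists_bound_of_continuousOn hh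
  exact integrableOn_halfBall (hh.mono halfBall_subset_closedHalf) (C := C)
    fun x hx => hC x (halfBall_subset_closedHalf hx)

/-- The conclusion of the divergence theorem with constant `A₀`, applied to harmonic functions. -/
theorem exists_const_green (m : ℕ) : ∃ A₀ : ℝ, 0 ≤ A₀ ∧
    (∀ (a b : Space m → ℝ) (A B : Space m → Space m) (κ : ℝ), HarmPair a A → HarmPair b B → 0 ≤ κ →
      (∀ x ∈ closedHalf m 1, x (idxN m) = 0 → -κ ≤ a x * B x (idxN m)) →
      ∫ x in halfBall (0 : Space m) 1, inner ℝ (A x) (B x) ≤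
        (∫ ω in hemi m, a ω * inner ℝ (ω : Space m) (B ω) ∂(sph m)) + κ * A₀) ∧
    (∀ (a b : Space m → ℝ) (A B : Space m → Space m) (κ : ℝ), HarmPair a A → HarmPair b B → 0 ≤ κ →
      (∀ x ∈ closedHalf m 1, x (idxN m) = 0 → -κ ≤ a x * B x (idxN m) - b x * A x (idxN m)) →
      0 ≤ (∫ ω in hemi m, (a ω * inner ℝ (ω : Space m) (B ω) - b ω * inner ℝ (ω : Space m) (A ω))
        ∂(sph m)) + κ * A₀) := by
  obtain ⟨A₀, h0, hA⟩ := exists_const_divergence m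
  refine ⟨A₀, h0, fun a b A B κ ha hb hκ hflat => ?_, fun a b A B κ ha hb hκ hflat => ?_⟩
  · obtain ⟨K, hK⟩ := (isCompact_closedHalf (m := m) 1).exists_bound_of_continuousOn
      (ha.contGrad.inner (𝕜 := ℝ) hb.contGrad)
    -- First Green formula: the divergence of a ∇b is ∇a · ∇b, which is bounded although the second
    -- derivatives of b need not be.
    have := hA (fun y => a y • B y) κ K hκ (ha.cont.smul hb.contGrad)
      (ha.contDiffOn.smul hb.c1) (fun x hx => by
        rw [ha.dvg_smul hb hx]; exact hK x (halfBall_subset_closedHalf hx))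
      (fun x hx hxn => by simpa using hflat x hx hxn)
    rw [setIntegral_congr_fun (isOpen_halfBall _ _).measurableSet
      fun x hx => ha.dvg_smul hb hx] at this
    simpa [inner_smul_right] using this
  · have hd : ∀ x ∈ halfBall (0 : Space m) 1,
        dvg (fun y => a y • B y + (-1 : ℝ) • (b y • A y)) x = 0 := by
      intro x hx
      have d1 : DifferentiableAt ℝ (fun y => a y • B y) x :=
        (ha.hasGrad x hx).differentiableAt.smul (hb.diffAt hx)
      have d2 : DifferentiableAt ℝ (fun y => b y • A y) x :=
        (hb.hasGrad x hx).differentiableAt.smul (ha.diffAt hx)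
      have d3 : DifferentiableAt ℝ (fun y => (-1 : ℝ) • (b y • A y)) x := d2.const_smul (-1 : ℝ)
      rw [dvg_add d1 d3, dvg_const_smul d2, ha.dvg_smul hb hx,
        hb.dvg_smul ha hx, real_inner_comm]
      ring
    have := hA (fun y => a y • B y + (-1 : ℝ) • (b y • A y)) κ 0 hκ
      ((ha.cont.smul hb.contGrad).add ((hb.cont.smul ha.contGrad).const_smul (-1 : ℝ)))
      ((ha.contDiffOn.smul hb.c1).add ((hb.contDiffOn.smul ha.c1).const_smul (-1 : ℝ)))
      (fun x hx => by rw [hd x hx]; simp)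
      (fun x hx hxn => by
        have := hflat x hx hxn
        simp
        linarith)
    rw [setIntegral_congr_fun (isOpen_halfBall _ _).measurableSet hd] at this
    simp only [inner_smul_right, inner_add_right] at this
    simpa [sub_eq_add_neg] using this

/-! ### Rescalings, and monotonicity of the Weiss energy without second derivatives -/

/-- On a uniform partition of mesh below δ the errors add up to ε. Thus increments need only be
bounded below up to o(r - s), uniformly, and f need not be differentiated. -/
theorem le_of_local_almost_mono {f : ℝ → ℝ} {a b : ℝ} (hab : a ≤ b)
    (h : ∀ ε > 0, ∃ δ > 0, ∀ s r, a ≤ s → s < r → r ≤ b → r - s < δ → -(ε * (r - s)) ≤ f r - f s) :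
    f a ≤ f b := by
  rcases hab.eq_or_lt with rfl | hab
  · exact le_rfl
  refine le_of_forall_pos_le_add fun ε hε => ?_
  obtain ⟨δ, hδ, H⟩ := h (ε / (b - a)) (div_pos hε (sub_pos.2 hab))
  obtain ⟨N, hN⟩ := exists_nat_gt ((b - a) / δ)
  have hba : 0 < b - a := sub_pos.2 hab
  have hN0 : (0 : ℝ) < N := lt_of_le_of_lt (by positivity) hN
  set t : ℕ → ℝ := fun i => a + i * ((b - a) / N)
  have hstep : ∀ i, t (i + 1) - t i = (b - a) / N := fun i => by simp only [t]; push_cast; ring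
  have hq : 0 < (b - a) / N := by positivity
  have hqN : (N : ℝ) * ((b - a) / N) = b - a := by field_simp
  have hsum := Finset.sum_range_sub (fun i => f (t i)) N
  have hle : ∑ i ∈ Finset.range N, -(ε / N) ≤ ∑ i ∈ Finset.range N, (f (t (i + 1)) - f (t i)) := by
    refine Finset.sum_le_sum fun i hi => ?_
    have hi' : ((i : ℝ) + 1) ≤ N := by exact_mod_cast Finset.mem_range.1 hi
    have h1 : a ≤ t i := by simp only [t]; have : 0 ≤ (i : ℝ) * ((b - a) / N) := by positivity
                            linarith
    have h2 : t (i + 1) ≤ b := by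
      simp only [t]; push_cast
      nlinarith
    have h3 := H (t i) (t (i + 1)) h1 (by linarith [hstep i]) h2 (by
      rw [hstep, div_lt_iff₀ hN0]; rw [div_lt_iff₀ hδ] at hN; linarith)
    rw [hstep] at h3
    have : ε / (b - a) * ((b - a) / N) = ε / N := by field_simp
    rwa [this] at h3
  rw [hsum] at hle
  have e1 : t 0 = a := by simp [t]
  have e2 : t N = b := by simp only [t]; rw [hqN]; ring
  rw [e1, e2, Finset.sum_const, Finset.card_range, nsmul_eq_mul] at hle
  have : (N : ℝ) * -(ε / N) = -ε := by field_simp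
  linarith

/-- The half ball `{‖x‖ < 1, 0 ≤ x_n}` together with its flat boundary. -/
def halfDom (m : ℕ) : Set (Space m) := {x | ‖x‖ < 1 ∧ 0 ≤ x (idxN m)}

/-- A solution `U` of the Signorini problem in the unit half ball, with gradient `G`. -/
structure SigData (U : Space m → ℝ) (G : Space m → Space m) : Prop where
  hasGrad : ∀ x ∈ halfDom m, HasFDerivWithinAt U (innerSL ℝ (G x)) (halfDom m) x
  contGrad : ContinuousOn G (halfDom m)
  c1 : ContDiffOn ℝ 1 G (halfBall 0 1)
  div_zero : ∀ x ∈ halfBall (0 : Space m) 1, dvg G x = 0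
  nonneg : ∀ x ∈ halfDom m, x (idxN m) = 0 → 0 ≤ U x
  normal_nonpos : ∀ x ∈ halfDom m, x (idxN m) = 0 → G x (idxN m) ≤ 0
  compl : ∀ x ∈ halfDom m, x (idxN m) = 0 → U x * G x (idxN m) = 0

/-- The `3/2`-homogeneous rescaling of a function. -/
def resc (U : Space m → ℝ) (r : ℝ) (x : Space m) : ℝ := r ^ (-(3 / 2) : ℝ) * U (r • x)

/-- The gradient of the `3/2`-homogeneous rescaling. -/
def rescGrad (G : Space m → Space m) (r : ℝ) (x : Space m) : Space m :=
  r ^ (-(1 / 2) : ℝ) • G (r • x)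

/-- The deviation of a rescaling from `3/2`-homogeneity. -/
def dev (U : Space m → ℝ) (G : Space m → Space m) (r : ℝ) (x : Space m) : ℝ :=
  inner ℝ x (rescGrad G r x) - 3 / 2 * resc U r x

/-- The Weiss energy. -/
def weiss (U : Space m → ℝ) (G : Space m → Space m) (r : ℝ) : ℝ :=
  (∫ x in halfBall (0 : Space m) 1, inner ℝ (rescGrad G r x) (rescGrad G r x)) -
    3 / 2 * ∫ ω in hemi m, resc U r ω * resc U r ω ∂(sph m)

theorem smul_mem_halfDom {r : ℝ} (hr : r ∈ Ioo (0 : ℝ) 1) {x : Space m} (hx : x ∈ closedHalf m 1) :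
    r • x ∈ halfDom m := by
  have := smul_mem_closedHalf hr.1.le hx
  exact ⟨this.1.trans_lt (by linarith [hr.2]), this.2⟩

theorem smul_mem_halfBall {r : ℝ} (hr : r ∈ Ioo (0 : ℝ) 1) {x : Space m}
    (hx : x ∈ halfBall (0 : Space m) 1) : r • x ∈ halfBall (0 : Space m) 1 := by
  refine ⟨?_, by simpa using mul_pos hr.1 hx.2⟩
  have h1 := mem_ball_zero_iff.1 hx.1
  rw [mem_ball_zero_iff, norm_smul, Real.norm_of_nonneg hr.1.le]
  nlinarith [hr.1, hr.2, norm_nonneg x]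

namespace SigData

variable {U : Space m → ℝ} {G : Space m → Space m}

theorem cont (h : SigData U G) : ContinuousOn U (halfDom m) :=
  fun x hx => (h.hasGrad x hx).continuousWithinAt

theorem hasGradAt (h : SigData U G) {x : Space m} (hx : x ∈ halfBall (0 : Space m) 1) :
    HasFDerivAt U (innerSL ℝ (G x)) x := by
  have hsub : halfBall (0 : Space m) 1 ⊆ halfDom m :=
    fun y hy => ⟨mem_ball_zero_iff.1 hy.1, hy.2.le⟩
  exact (h.hasGrad x (hsub hx)).hasFDerivAt
    (mem_of_superset ((isOpen_halfBall _ _).mem_nhds hx) hsub)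

theorem hasDerivAt_ray (h : SigData U G) {r : ℝ} (hr : r ∈ Ioo (0 : ℝ) 1) {x : Space m}
    (hx : x ∈ closedHalf m 1) :
    HasDerivAt (fun t : ℝ => U (t • x)) (inner ℝ (G (r • x)) x) r := by
  have h1 : HasDerivAt (fun t : ℝ => t • x) x r := by
    simpa using (hasDerivAt_id r).smul_const x
  have hev : ∀ᶠ t : ℝ in 𝓝 r, t • x ∈ halfDom m := by
    filter_upwards [Ioo_mem_nhds hr.1 hr.2] with t ht using smul_mem_halfDom ht hx
  exact (h.hasGrad _ (smul_mem_halfDom hr hx)).comp_hasDerivAt r h1 hev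

/-- The reason for introducing `dev`: it is r times the derivative of the rescaling in r. -/
theorem hasDerivAt_resc (h : SigData U G) {r : ℝ} (hr : r ∈ Ioo (0 : ℝ) 1) {x : Space m}
    (hx : x ∈ closedHalf m 1) :
    HasDerivAt (fun t : ℝ => resc U t x) (r⁻¹ * dev U G r x) r := by
  have h1 := (Real.hasDerivAt_rpow_const (p := (-(3 / 2) : ℝ)) (Or.inl hr.1.ne')).mul
    (h.hasDerivAt_ray hr hx)
  refine h1.congr_deriv ?_
  have e1 : r ^ (-(3 / 2) - 1 : ℝ) = r⁻¹ * r ^ (-(3 / 2) : ℝ) := by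
    rw [Real.rpow_sub hr.1, Real.rpow_one]; field_simp
  have e2 : r ^ (-(3 / 2) : ℝ) = r⁻¹ * r ^ (-(1 / 2) : ℝ) := by
    rw [show (-(3 / 2) : ℝ) = -(1 / 2) - 1 by norm_num, Real.rpow_sub hr.1, Real.rpow_one]
    field_simp
  simp only [dev, resc, rescGrad, inner_smul_right]
  rw [e1, real_inner_comm x (G (r • x))]
  rw [e2]
  ring

theorem harmPair (h : SigData U G) {r : ℝ} (hr : r ∈ Ioo (0 : ℝ) 1) :
    HarmPair (resc U r) (rescGrad G r) where
  cont := continuousOn_const.mul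
    (h.cont.comp (by fun_prop) fun x hx => smul_mem_halfDom hr hx)
  contGrad := (h.contGrad.comp (by fun_prop) fun x hx => smul_mem_halfDom hr hx).const_smul
    (r ^ (-(1 / 2) : ℝ))
  hasGrad x hx := by
    have h1 : HasFDerivAt (fun y : Space m => r • y) (r • ContinuousLinearMap.id ℝ (Space m)) x :=
      (hasFDerivAt_id x).const_smul r
    have h2 := ((h.hasGradAt (smul_mem_halfBall hr hx)).comp x h1).const_mul (r ^ (-(3 / 2) : ℝ))
    refine h2.congr_fderiv ?_
    have e2 : r ^ (-(1 / 2) : ℝ) = r ^ (-(3 / 2) : ℝ) * r := by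
      rw [show (-(1 / 2) : ℝ) = -(3 / 2) + 1 by norm_num, Real.rpow_add hr.1, Real.rpow_one]
    ext v
    simp only [rescGrad, e2, smul_apply, ContinuousLinearMap.comp_apply,
      innerSL_apply_apply, inner_smul_left, inner_smul_right, ContinuousLinearMap.id_apply,
      smul_eq_mul, conj_trivial]
    ring
  c1 := by
    have : ContDiffOn ℝ 1 (fun x : Space m => G (r • x)) (halfBall 0 1) :=
      h.c1.comp (contDiff_const_smul r).contDiffOn fun x hx => smul_mem_halfBall hr hx
    exact this.const_smul (r ^ (-(1 / 2) : ℝ))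
  div_zero x hx := by
    have hG : DifferentiableAt ℝ G (r • x) :=
      (h.c1.contDiffAt ((isOpen_halfBall _ _).mem_nhds
        (smul_mem_halfBall hr hx))).differentiableAt one_ne_zero
    have h1 : HasFDerivAt (fun y : Space m => r • y) (r • ContinuousLinearMap.id ℝ (Space m)) x :=
      (hasFDerivAt_id x).const_smul r
    have h2 : HasFDerivAt (fun y => G (r • y)) _ x := hG.hasFDerivAt.comp x h1
    have h3 : dvg (fun y => G (r • y)) x = r * dvg G (r • x) := by
      simp only [dvg, h2.fderiv, Finset.mul_sum]
      simp
    unfold rescGrad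
    rw [dvg_const_smul h2.differentiableAt, h3, h.div_zero _ (smul_mem_halfBall hr hx)]
    simp

theorem continuousOn_resc (h : SigData U G) {s₀ r₀ : ℝ} (hs : 0 < s₀) (hr : r₀ < 1) :
    ContinuousOn (fun q : ℝ × Space m => resc U q.1 q.2) (Icc s₀ r₀ ×ˢ closedHalf m 1) := by
  refine ContinuousOn.mul ?_ ?_
  · exact continuousOn_fst.rpow_const fun q hq => Or.inl (hs.trans_le hq.1.1).ne'
  · exact h.cont.comp (continuousOn_fst.smul continuousOn_snd) fun q hq =>
      smul_mem_halfDom ⟨hs.trans_le hq.1.1, hq.1.2.trans_lt hr⟩ hq.2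

theorem continuousOn_rescGrad (h : SigData U G) {s₀ r₀ : ℝ} (hs : 0 < s₀) (hr : r₀ < 1) :
    ContinuousOn (fun q : ℝ × Space m => rescGrad G q.1 q.2) (Icc s₀ r₀ ×ˢ closedHalf m 1) := by
  have e1 : ContinuousOn (fun q : ℝ × Space m => q.1 ^ (-(1 / 2) : ℝ))
      (Icc s₀ r₀ ×ˢ closedHalf m 1) :=
    continuousOn_fst.rpow_const fun q hq => Or.inl (hs.trans_le hq.1.1).ne'
  have e2 : ContinuousOn (fun q : ℝ × Space m => G (q.1 • q.2)) (Icc s₀ r₀ ×ˢ closedHalf m 1) :=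
    h.contGrad.comp (continuousOn_fst.smul continuousOn_snd) fun q hq =>
      smul_mem_halfDom ⟨hs.trans_le hq.1.1, hq.1.2.trans_lt hr⟩ hq.2
  exact e1.smul e2

theorem continuousOn_dev (h : SigData U G) {s₀ r₀ : ℝ} (hs : 0 < s₀) (hr : r₀ < 1) :
    ContinuousOn (fun q : ℝ × Space m => dev U G q.1 q.2) (Icc s₀ r₀ ×ˢ closedHalf m 1) :=
  (continuousOn_snd.inner (h.continuousOn_rescGrad hs hr)).sub
    (continuousOn_const.mul (h.continuousOn_resc hs hr))

theorem dev_cont (h : SigData U G) {r : ℝ} (hr : r ∈ Ioo (0 : ℝ) 1) :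
    ContinuousOn (dev U G r) (closedHalf m 1) :=
  (continuousOn_id.inner (h.harmPair hr).contGrad).sub
    (continuousOn_const.mul (h.harmPair hr).cont)

theorem resc_nonneg (h : SigData U G) {r : ℝ} (hr : r ∈ Ioo (0 : ℝ) 1) {x : Space m}
    (hx : x ∈ closedHalf m 1) (hn : x (idxN m) = 0) : 0 ≤ resc U r x :=
  mul_nonneg (Real.rpow_nonneg hr.1.le _)
    (h.nonneg _ (smul_mem_halfDom hr hx) (by simp [hn]))

theorem rescGrad_nonpos (h : SigData U G) {r : ℝ} (hr : r ∈ Ioo (0 : ℝ) 1) {x : Space m}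
    (hx : x ∈ closedHalf m 1) (hn : x (idxN m) = 0) : rescGrad G r x (idxN m) ≤ 0 := by
  have := h.normal_nonpos _ (smul_mem_halfDom hr hx) (by simp [hn])
  simpa [rescGrad] using mul_nonpos_of_nonneg_of_nonpos
    (Real.rpow_nonneg hr.1.le (-(1 / 2) : ℝ)) this

theorem resc_compl (h : SigData U G) {r : ℝ} (hr : r ∈ Ioo (0 : ℝ) 1) {x : Space m}
    (hx : x ∈ closedHalf m 1) (hn : x (idxN m) = 0) :
    resc U r x * rescGrad G r x (idxN m) = 0 := by
  have := h.compl _ (smul_mem_halfDom hr hx) (by simp [hn])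
  simp only [resc, rescGrad, PiLp.smul_apply, smul_eq_mul]
  linear_combination (r ^ (-(3 / 2) : ℝ) * r ^ (-(1 / 2) : ℝ)) * this

/-- Where the normal derivative does not vanish, both the rescaling and its radial derivative
vanish. -/
theorem dev_eq_zero (h : SigData U G) {r : ℝ} (hr : r ∈ Ioo (0 : ℝ) 1) {x : Space m}
    (hx : x ∈ closedHalf m 1) (hn : x (idxN m) = 0) (hne : rescGrad G r x (idxN m) ≠ 0) :
    resc U r x = 0 ∧ dev U G r x = 0 := by
  have h0 : resc U r x = 0 := (mul_eq_zero.1 (h.resc_compl hr hx hn)).resolve_right hne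
  refine ⟨h0, ?_⟩
  -- At a fixed flat point the rescalings are nonnegative for all scales and zero at r, so their
  -- derivative in the scale vanishes there.
  have hmin : IsLocalMin (fun t : ℝ => resc U t x) r := by
    filter_upwards [Ioo_mem_nhds hr.1 hr.2] with t ht
    rw [h0]
    exact h.resc_nonneg ht hx hn
  have := hmin.hasDerivAt_eq_zero (h.hasDerivAt_resc hr hx)
  exact (mul_eq_zero.1 this).resolve_left (inv_ne_zero hr.1.ne')

/-- Mean value theorem for the rescalings. -/
theorem exists_resc_sub (h : SigData U G) {s r : ℝ} (hs : 0 < s) (hsr : s < r) (hr : r < 1)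
    {x : Space m} (hx : x ∈ closedHalf m 1) :
    ∃ ξ ∈ Ioo s r, resc U r x - resc U s x = (r - s) * (ξ⁻¹ * dev U G ξ x) := by
  have hd : ∀ t ∈ Icc s r, HasDerivAt (fun t => resc U t x) (t⁻¹ * dev U G t x) t := fun t ht =>
    h.hasDerivAt_resc ⟨hs.trans_le ht.1, ht.2.trans_lt hr⟩ hx
  obtain ⟨ξ, hξ, he⟩ := exists_hasDerivAt_eq_slope (fun t => resc U t x) _ hsr
    (fun t ht => (hd t ht).continuousAt.continuousWithinAt) fun t ht => hd t (Ioo_subset_Icc_self ht)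
  refine ⟨ξ, hξ, ?_⟩
  rw [he]
  have : r - s ≠ 0 := (sub_pos.2 hsr).ne'
  field_simp

end SigData

theorem integral_linear_combination {Ω : Type*} [MeasurableSpace Ω] {μ : Measure Ω} {f g h : Ω → ℝ}
    (hf : Integrable f μ) (hg : Integrable g μ) (hh : Integrable h μ) (a b c : ℝ) :
    ∫ ω, (a * f ω + b * g ω + c * h ω) ∂μ = a * ∫ ω, f ω ∂μ + b * ∫ ω, g ω ∂μ + c * ∫ ω, h ω ∂μ := by
  have h1 : Integrable (fun ω => a * f ω + b * g ω) μ := (hf.const_mul a).add (hg.const_mul b)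
  rw [integral_add h1 (hh.const_mul c), integral_add (hf.const_mul a) (hg.const_mul b),
    integral_const_mul, integral_const_mul, integral_const_mul]

namespace SigData

variable {U : Space m → ℝ} {G : Space m → Space m}

/-- The increment of the Weiss energy. -/
theorem weiss_sub_ge (h : SigData U G) {A₀ : ℝ}
    (hA₀ : ∀ (a b : Space m → ℝ) (A B : Space m → Space m) (κ : ℝ), HarmPair a A → HarmPair b B →
      0 ≤ κ → (∀ x ∈ closedHalf m 1, x (idxN m) = 0 → -κ ≤ a x * B x (idxN m)) →
      ∫ x in halfBall (0 : Space m) 1, inner ℝ (A x) (B x) ≤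
        (∫ ω in hemi m, a ω * inner ℝ (ω : Space m) (B ω) ∂(sph m)) + κ * A₀)
    {s r κ : ℝ} (hs : s ∈ Ioo (0 : ℝ) 1) (hr : r ∈ Ioo (0 : ℝ) 1) (hκ : 0 ≤ κ)
    (hflat : ∀ x ∈ closedHalf m 1, x (idxN m) = 0 →
      (resc U r x - resc U s x) * (rescGrad G r x (idxN m) + rescGrad G s x (idxN m)) ≤ κ) :
    (∫ ω in hemi m, (resc U r ω - resc U s ω) * (dev U G r ω + dev U G s ω) ∂(sph m)) - κ * A₀ ≤
      weiss U G r - weiss U G s := by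
  have pr := h.harmPair hr
  have ps := h.harmPair hs
  -- Green's formula for U_r - U_s against -(∇U_r + ∇U_s): the product of gradients is |∇U_s|² -
  -- |∇U_r|², and the minus sign turns the upper bound into a lower bound for the increment.
  have g := hA₀ _ _ _ _ κ (pr.add (ps.const_mul (-1))) ((pr.add ps).const_mul (-1)) hκ
    (fun x hx hn => by
      have := hflat x hx hn
      simp only [PiLp.smul_apply, PiLp.add_apply, smul_eq_mul]
      linarith)
  have e1 : ∫ x in halfBall (0 : Space m) 1, inner ℝ (rescGrad G r x + (-1 : ℝ) • rescGrad G s x)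
      ((-1 : ℝ) • (rescGrad G r x + rescGrad G s x)) =
      (∫ x in halfBall (0 : Space m) 1, inner ℝ (rescGrad G s x) (rescGrad G s x)) -
      ∫ x in halfBall (0 : Space m) 1, inner ℝ (rescGrad G r x) (rescGrad G r x) := by
    rw [← integral_sub (integrableOn_halfBall_of_continuousOn (ps.contGrad.inner ps.contGrad))
      (integrableOn_halfBall_of_continuousOn (pr.contGrad.inner pr.contGrad))]
    congr 1
    funext x
    simp only [inner_add_left, inner_add_right, inner_smul_left, inner_smul_right]
    rw [real_inner_comm (rescGrad G s x) (rescGrad G r x)]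
    simp
    ring
  rw [e1] at g
  have i1 := integrableOn_hemi_of_continuousOn (pr.cont.mul pr.cont)
  have i2 := integrableOn_hemi_of_continuousOn (ps.cont.mul ps.cont)
  have i3 := integrableOn_hemi_of_continuousOn ((pr.cont.sub ps.cont).mul
    ((h.dev_cont hr).add (h.dev_cont hs)))
  -- Replacing x·∇U_t by `dev` + (3/2) U_t produces precisely the sphere part of the Weiss energy.
  have e2 : ∫ ω in hemi m, (resc U r ω + -1 * resc U s ω) *
      inner ℝ (ω : Space m) ((-1 : ℝ) • (rescGrad G r ω + rescGrad G s ω)) ∂(sph m) =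
      3 / 2 * (∫ ω in hemi m, resc U s ω * resc U s ω ∂(sph m)) -
      3 / 2 * (∫ ω in hemi m, resc U r ω * resc U r ω ∂(sph m)) -
      (∫ ω in hemi m, (resc U r ω - resc U s ω) * (dev U G r ω + dev U G s ω) ∂(sph m)) := by
    have lin := integral_linear_combination (μ := (sph m).restrict (hemi m))
      (f := fun ω => resc U s ω * resc U s ω) (g := fun ω => resc U r ω * resc U r ω)
      (h := fun ω => (resc U r ω - resc U s ω) * (dev U G r ω + dev U G s ω))
      i2 i1 i3 (3 / 2) (-(3 / 2)) (-1)
    rw [show ∀ x y z : ℝ, 3 / 2 * x - 3 / 2 * y - z = 3 / 2 * x + -(3 / 2) * y + -1 * z from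
      fun x y z => by ring, ← lin]
    congr 1
    funext ω
    simp only [dev, inner_add_right, inner_smul_right]
    ring
  rw [e2] at g
  simp only [weiss]
  linarith

/-- By the mean value theorem U_r - U_s = (r - s) ξ⁻¹ dev_ξ, and `dev` is uniformly continuous in
scale and position, so the sphere term of the increment is an integral of (r - s) ξ⁻¹ (2 dev_ξ² +
o(1)). The flat term is o(r - s) by complementarity. -/
theorem weiss_mono (h : SigData U G) {s₀ r₀ : ℝ} (hs : 0 < s₀) (hsr : s₀ ≤ r₀) (hr : r₀ < 1) :
    weiss U G s₀ ≤ weiss U G r₀ := by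
  obtain ⟨A₀, hA0, hA₀, -⟩ := exists_const_green m
  have hcK : IsCompact (Icc s₀ r₀ ×ˢ closedHalf m 1) := isCompact_Icc.prod (isCompact_closedHalf 1)
  obtain ⟨B, hB⟩ := hcK.exists_bound_of_continuousOn (h.continuousOn_dev hs hr)
  obtain ⟨BA, hBA⟩ := hcK.exists_bound_of_continuousOn (h.continuousOn_rescGrad hs hr)
  have huc := hcK.uniformContinuousOn_of_continuous (h.continuousOn_dev hs hr)
  rw [Metric.uniformContinuousOn_iff] at huc
  set S := (sph m).real (hemi m)
  have hS : 0 ≤ S := measureReal_nonneg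
  -- Collects the constants of the sphere and flat errors per unit of (r - s) η; the added 1 makes
  -- it positive.
  set Q := s₀⁻¹ * (2 * |B| * S + |BA| * A₀) + 1
  have hs₀ : 0 < s₀⁻¹ := inv_pos.2 hs
  have hQ : 0 < Q := by positivity
  refine le_of_local_almost_mono hsr fun ε hε => ?_
  obtain ⟨δ, hδ, hδ'⟩ := huc (ε / Q) (div_pos hε hQ)
  refine ⟨δ, hδ, fun s r hs1 hsr1 hr1 hlt => ?_⟩
  set η := ε / Q
  have hη : 0 < η := div_pos hε hQ
  have hsI : s ∈ Icc s₀ r₀ := ⟨hs1, hsr1.le.trans hr1⟩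
  have hrI : r ∈ Icc s₀ r₀ := ⟨hs1.trans hsr1.le, hr1⟩
  have hsO : s ∈ Ioo (0 : ℝ) 1 := ⟨hs.trans_le hsI.1, hsI.2.trans_lt hr⟩
  have hrO : r ∈ Ioo (0 : ℝ) 1 := ⟨hs.trans_le hrI.1, hrI.2.trans_lt hr⟩
  have hd0 : 0 < r - s := sub_pos.2 hsr1
  have hclose : ∀ t ∈ Icc s r, ∀ t' ∈ Icc s r, ∀ x ∈ closedHalf m 1,
      |dev U G t x - dev U G t' x| < η := by
    intro t ht t' ht' x hx
    have := hδ' (t, x) ⟨⟨hs1.trans ht.1, ht.2.trans hr1⟩, hx⟩ (t', x)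
      ⟨⟨hs1.trans ht'.1, ht'.2.trans hr1⟩, hx⟩ (by
        rw [Prod.dist_eq]
        simp only [dist_self, Real.dist_eq]
        rw [max_lt_iff]
        exact ⟨lt_of_le_of_lt (abs_le.2 ⟨by linarith [ht.1, ht'.2], by linarith [ht.2, ht'.1]⟩) hlt,
          hδ⟩)
    simpa [Real.dist_eq] using this
  have hξ : ∀ ξ ∈ Ioo s r, 0 < ξ⁻¹ ∧ ξ⁻¹ ≤ s₀⁻¹ := fun ξ hξ =>
    ⟨inv_pos.2 (hsO.1.trans hξ.1), inv_anti₀ hs (hs1.trans hξ.1.le)⟩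
  set κ := (r - s) * (s₀⁻¹ * (η * |BA|))
  have hκ : 0 ≤ κ := by positivity
  have hmain := h.weiss_sub_ge hA₀ hsO hrO hκ fun x hx hn => by
    have c1 := h.resc_compl hsO hx hn
    have c2 := h.resc_compl hrO hx hn
    have c3 := mul_nonneg (h.resc_nonneg hrO hx hn) (neg_nonneg.2 (h.rescGrad_nonpos hsO hx hn))
    -- By complementarity and signs only -U_s ∂_n U_r can be harmful. Where ∂_n U_r ≠ 0, both U_r
    -- and dev_r vanish, so U_s = -(r - s) ξ⁻¹ dev_ξ with |dev_ξ| ≤ η.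
    have c4 : -(resc U s x * rescGrad G r x (idxN m)) ≤ κ := by
      by_cases hne : rescGrad G r x (idxN m) = 0
      · rw [hne, mul_zero, neg_zero]; exact hκ
      obtain ⟨z1, z2⟩ := h.dev_eq_zero hrO hx hn hne
      obtain ⟨ξ, hξI, he⟩ := h.exists_resc_sub hsO.1 hsr1 hrO.2 hx
      have hdξ : |dev U G ξ x| ≤ η := by
        have := hclose ξ (Ioo_subset_Icc_self hξI) r (right_mem_Icc.2 hsr1.le) x hx
        rw [z2, sub_zero] at this
        exact this.le
      have hBA' : |rescGrad G r x (idxN m)| ≤ |BA| :=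
        (PiLp.norm_apply_le (rescGrad G r x) (idxN m)).trans
          ((hBA (r, x) ⟨hrI, hx⟩).trans (le_abs_self _))
      have : -(resc U s x * rescGrad G r x (idxN m)) =
          (r - s) * (ξ⁻¹ * (dev U G ξ x * rescGrad G r x (idxN m))) := by
        have : -resc U s x = (r - s) * (ξ⁻¹ * dev U G ξ x) := by rw [← he, z1]; ring
        linear_combination rescGrad G r x (idxN m) * this
      rw [this]
      refine mul_le_mul_of_nonneg_left ?_ hd0.le
      have h5 : dev U G ξ x * rescGrad G r x (idxN m) ≤ η * |BA| :=
        (le_abs_self _).trans (by rw [abs_mul]; exact mul_le_mul hdξ hBA' (abs_nonneg _) hη.le)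
      calc ξ⁻¹ * (dev U G ξ x * rescGrad G r x (idxN m)) ≤ ξ⁻¹ * (η * |BA|) :=
            mul_le_mul_of_nonneg_left h5 (hξ ξ hξI).1.le
        _ ≤ s₀⁻¹ * (η * |BA|) := mul_le_mul_of_nonneg_right (hξ ξ hξI).2 (by positivity)
    linarith
  have hint : -((r - s) * (s₀⁻¹ * (2 * |B| * η))) * S ≤
      ∫ ω in hemi m, (resc U r ω - resc U s ω) * (dev U G r ω + dev U G s ω) ∂(sph m) := by
    have hc : ∫ _ in hemi m, -((r - s) * (s₀⁻¹ * (2 * |B| * η))) ∂(sph m) =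
        -((r - s) * (s₀⁻¹ * (2 * |B| * η))) * S := by
      rw [setIntegral_const, smul_eq_mul, mul_comm]
    rw [← hc]
    refine setIntegral_mono_on (integrable_const _) ?_ measurableSet_hemi fun ω hω => ?_
    · exact integrableOn_hemi_of_continuousOn
        (((h.harmPair hrO).cont.sub (h.harmPair hsO).cont).mul
        ((h.dev_cont hrO).add (h.dev_cont hsO)))
    have hx := hemi_mem_closedHalf hω
    obtain ⟨ξ, hξI, he⟩ := h.exists_resc_sub hsO.1 hsr1 hrO.2 hx
    rw [he]
    have h1 := hclose r (right_mem_Icc.2 hsr1.le) ξ (Ioo_subset_Icc_self hξI) _ hx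
    have h2 := hclose s (left_mem_Icc.2 hsr1.le) ξ (Ioo_subset_Icc_self hξI) _ hx
    have h3 : |dev U G ξ ω| ≤ |B| :=
      (hB (ξ, ω) ⟨⟨hs1.trans hξI.1.le, hξI.2.le.trans hr1⟩, hx⟩).trans (le_abs_self _)
    set d := dev U G ξ ω
    set d1 := dev U G r ω
    set d2 := dev U G s ω
    have h4 : -(2 * |B| * η) ≤ d * (d1 + d2) := by
      have e : d * (d1 + d2) = 2 * d ^ 2 + d * ((d1 - d) + (d2 - d)) := by ring
      have h5 : |d * ((d1 - d) + (d2 - d))| ≤ |B| * (2 * η) := by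
        rw [abs_mul]
        refine mul_le_mul h3 ((abs_add_le _ _).trans (by linarith)) (abs_nonneg _) (abs_nonneg _)
      have := neg_abs_le (d * ((d1 - d) + (d2 - d)))
      nlinarith [sq_nonneg d]
    have h6 : -(s₀⁻¹ * (2 * |B| * η)) ≤ ξ⁻¹ * (d * (d1 + d2)) := by
      have a1 : ξ⁻¹ * -(2 * |B| * η) ≤ ξ⁻¹ * (d * (d1 + d2)) :=
        mul_le_mul_of_nonneg_left h4 (hξ ξ hξI).1.le
      have a2 : ξ⁻¹ * (2 * |B| * η) ≤ s₀⁻¹ * (2 * |B| * η) :=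
        mul_le_mul_of_nonneg_right (hξ ξ hξI).2 (by positivity)
      linarith
    have := mul_le_mul_of_nonneg_left h6 hd0.le
    linarith
  have hfin : (r - s) * (s₀⁻¹ * (2 * |B| * η)) * S + κ * A₀ ≤ ε * (r - s) := by
    have e : (r - s) * (s₀⁻¹ * (2 * |B| * η)) * S + κ * A₀ =
        (r - s) * (η * (Q - 1)) := by simp only [κ, Q]; ring
    rw [e]
    have : η * Q = ε := by simp only [η]; field_simp
    nlinarith
  linarith

/-- A nondecreasing function on (0, 1) lies above its limit at 0. -/
theorem weiss_nonneg (h : SigData U G) (h0 : Tendsto (weiss U G) (𝓝[>] 0) (𝓝 0)) {r : ℝ}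
    (hr : r ∈ Ioo (0 : ℝ) 1) : 0 ≤ weiss U G r := by
  refine le_of_tendsto h0 ?_
  filter_upwards [Ioo_mem_nhdsGT hr.1] with s hs
  exact h.weiss_mono hs.1 hs.2.le hr.2

/-! ### The Monneau argument for an abstract solution and profile -/

/-- The derivative of the distance to a fixed profile on the half sphere. -/
theorem hasDerivAt_hemi_sq (h : SigData U G) {p : Space m → ℝ}
    (hp : ContinuousOn p (closedHalf m 1)) {r : ℝ} (hr : r ∈ Ioo (0 : ℝ) 1) :
    HasDerivAt (fun t => ∫ ω in hemi m, (resc U t ω - p ω) ^ 2 ∂(sph m))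
      (∫ ω in hemi m, 2 * (resc U r ω - p ω) * (r⁻¹ * dev U G r ω) ∂(sph m)) r := by
  have hs : 0 < r / 2 := half_pos hr.1
  have hr' : (1 + r) / 2 < 1 := by linarith [hr.2]
  have hcK : IsCompact (Icc (r / 2) ((1 + r) / 2) ×ˢ closedHalf m 1) :=
    isCompact_Icc.prod (isCompact_closedHalf 1)
  have hmem : Icc (r / 2) ((1 + r) / 2) ∈ 𝓝 r := Icc_mem_nhds (by linarith [hr.1]) (by linarith [hr.2])
  have hI : ∀ t ∈ Icc (r / 2) ((1 + r) / 2), t ∈ Ioo (0 : ℝ) 1 :=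
    fun t ht => ⟨hs.trans_le ht.1, ht.2.trans_lt hr'⟩
  have hF' : ContinuousOn (fun q : ℝ × Space m =>
      2 * (resc U q.1 q.2 - p q.2) * (q.1⁻¹ * dev U G q.1 q.2))
      (Icc (r / 2) ((1 + r) / 2) ×ˢ closedHalf m 1) := by
    have hp' : ContinuousOn (fun q : ℝ × Space m => p q.2)
        (Icc (r / 2) ((1 + r) / 2) ×ˢ closedHalf m 1) :=
      hp.comp continuousOn_snd fun q hq => hq.2
    refine (continuousOn_const.mul ((h.continuousOn_resc hs hr').sub hp')).mul
      (ContinuousOn.mul ?_ (h.continuousOn_dev hs hr'))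
    exact continuousOn_fst.inv₀ fun q hq => (hI q.1 hq.1).1.ne'
  obtain ⟨C, hC⟩ := hcK.exists_bound_of_continuousOn hF'
  refine (hasDerivAt_integral_of_dominated_loc_of_deriv_le (bound := fun _ => C)
    (F := fun t (ω : Metric.sphere (0 : Space m) 1) => (resc U t ω - p ω) ^ 2)
    (F' := fun t (ω : Metric.sphere (0 : Space m) 1) =>
      2 * (resc U t ω - p ω) * (t⁻¹ * dev U G t ω)) hmem ?_ ?_ ?_ ?_ ?_ ?_).2
  · filter_upwards [hmem] with t ht
    exact (integrableOn_hemi_of_continuousOn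
      (((h.harmPair (hI t ht)).cont.sub hp).pow 2)).aestronglyMeasurable
  · exact integrableOn_hemi_of_continuousOn (((h.harmPair hr).cont.sub hp).pow 2)
  · exact (integrableOn_hemi_of_continuousOn ((continuousOn_const.mul
      ((h.harmPair hr).cont.sub hp)).mul
      (continuousOn_const.mul (h.dev_cont hr)))).aestronglyMeasurable
  · filter_upwards [ae_restrict_mem measurableSet_hemi] with ω hω t ht
    exact hC (t, ω) ⟨ht, hemi_mem_closedHalf hω⟩
  · exact integrable_const _
  · filter_upwards [ae_restrict_mem measurableSet_hemi] with ω hω t ht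
    have := ((h.hasDerivAt_resc (hI t ht) (hemi_mem_closedHalf hω)).sub_const (p ω)).pow 2
    refine this.congr_deriv ?_
    simp

end SigData

/-- Monneau-type monotonicity for a solution compared with a `3/2`-homogeneous harmonic profile. -/
theorem exists_const_monotone (m : ℕ) : ∃ A₀ : ℝ, 0 ≤ A₀ ∧
    ∀ (U : Space m → ℝ) (G : Space m → Space m) (p : Space m → ℝ) (Q : Space m → Space m)
      (c₀ κ α : ℝ), SigData U G → HarmPair p Q →
      (∀ ω ∈ hemi m, inner ℝ (ω : Space m) (Q ω) = 3 / 2 * p ω) →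
      (∀ x ∈ closedHalf m 1, x (idxN m) = 0 → 0 ≤ p x) →
      Tendsto (weiss U G) (𝓝[>] 0) (𝓝 0) → 0 ≤ c₀ → 0 ≤ κ → 0 < α →
      (∀ r ∈ Ioo (0 : ℝ) 1, ∀ x ∈ closedHalf m 1, x (idxN m) = 0 →
        -(κ * r ^ α) ≤ resc U r x * Q x (idxN m)) →
      MonotoneOn (fun r : ℝ => (∫ ω in hemi m, (resc U r ω - c₀ * p ω) ^ 2 ∂(sph m)) +
        2 * c₀ * κ * A₀ / α * r ^ α) (Ioo 0 1) := by
  obtain ⟨A₀, hA0, hA1, hA2⟩ := exists_const_green m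
  refine ⟨A₀, hA0, fun U G p Q c₀ κ α h hp hhom hpos hW hc hκ hα hflat => ?_⟩
  have hder : ∀ r ∈ Ioo (0 : ℝ) 1, HasDerivAt
      (fun r : ℝ => (∫ ω in hemi m, (resc U r ω - c₀ * p ω) ^ 2 ∂(sph m)) +
        2 * c₀ * κ * A₀ / α * r ^ α)
      ((∫ ω in hemi m, 2 * (resc U r ω - c₀ * p ω) * (r⁻¹ * dev U G r ω) ∂(sph m)) +
        2 * c₀ * κ * A₀ / α * (α * r ^ (α - 1))) r := fun r hr =>
    (h.hasDerivAt_hemi_sq (continuousOn_const.mul hp.cont) hr).add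
      ((Real.hasDerivAt_rpow_const (Or.inl hr.1.ne')).const_mul _)
  refine monotoneOn_of_deriv_nonneg (convex_Ioo 0 1)
    (fun r hr => (hder r hr).continuousAt.continuousWithinAt)
    (fun r hr => (hder r (interior_subset hr)).differentiableAt.differentiableWithinAt) ?_
  intro r hr
  have hr : r ∈ Ioo (0 : ℝ) 1 := interior_subset hr
  rw [(hder r hr).deriv]
  have pr := h.harmPair hr
  have hrα : 0 ≤ r ^ α := Real.rpow_nonneg hr.1.le _
  -- No flat error here: U_r ∂_n U_r = 0.
  have g1 := hA1 _ _ _ _ 0 pr pr le_rfl fun x hx hn => by rw [h.resc_compl hr hx hn, neg_zero]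
  -- The contribution -p ∂_n U_r has the good sign, so only U_r ∂_n p is charged to the error.
  have g2 := hA2 _ _ _ _ (κ * r ^ α) pr hp (by positivity) fun x hx hn => by
    have := mul_nonpos_of_nonneg_of_nonpos (hpos x hx hn) (h.rescGrad_nonpos hr hx hn)
    have := hflat r hr x hx hn
    linarith
  have w := h.weiss_nonneg hW hr
  rw [weiss] at w
  have hdot : ContinuousOn (fun x : Space m => inner ℝ x (rescGrad G r x)) (closedHalf m 1) :=
    continuousOn_id.inner pr.contGrad
  have hdotQ : ContinuousOn (fun x : Space m => inner ℝ x (Q x)) (closedHalf m 1) :=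
    continuousOn_id.inner hp.contGrad
  have i1 := integrableOn_hemi_of_continuousOn (pr.cont.mul hdot)
  have i2 := integrableOn_hemi_of_continuousOn (pr.cont.mul pr.cont)
  have i3 := integrableOn_hemi_of_continuousOn ((pr.cont.mul hdotQ).sub (hp.cont.mul hdot))
  have e : ∫ ω in hemi m, 2 * (resc U r ω - c₀ * p ω) * (r⁻¹ * dev U G r ω) ∂(sph m) =
      2 * r⁻¹ * ((∫ ω in hemi m, resc U r ω * inner ℝ (ω : Space m) (rescGrad G r ω) ∂(sph m)) -
      3 / 2 * (∫ ω in hemi m, resc U r ω * resc U r ω ∂(sph m)) +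
      c₀ * ∫ ω in hemi m, (resc U r ω * inner ℝ (ω : Space m) (Q ω) -
        p ω * inner ℝ (ω : Space m) (rescGrad G r ω)) ∂(sph m)) := by
    have lin := integral_linear_combination (μ := (sph m).restrict (hemi m))
      (f := fun ω => resc U r ω * inner ℝ (ω : Space m) (rescGrad G r ω))
      (g := fun ω => resc U r ω * resc U r ω)
      (h := fun ω => resc U r ω * inner ℝ (ω : Space m) (Q ω) -
        p ω * inner ℝ (ω : Space m) (rescGrad G r ω))
      i1 i2 i3 (2 * r⁻¹) (2 * r⁻¹ * -(3 / 2)) (2 * r⁻¹ * c₀)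
    rw [show ∀ x y z : ℝ, 2 * r⁻¹ * (x - 3 / 2 * y + c₀ * z) =
      2 * r⁻¹ * x + 2 * r⁻¹ * -(3 / 2) * y + 2 * r⁻¹ * c₀ * z from fun x y z => by ring, ← lin]
    refine setIntegral_congr_fun measurableSet_hemi fun ω hω => ?_
    simp only [dev, hhom ω hω]
    ring
  rw [e]
  -- The coefficient of r^α is chosen so that its derivative equals the Green error term.
  have e3 : 2 * c₀ * κ * A₀ / α * (α * r ^ (α - 1)) = 2 * r⁻¹ * (c₀ * (κ * r ^ α * A₀)) := by
    rw [Real.rpow_sub hr.1, Real.rpow_one]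
    field_simp
  rw [e3, ← mul_add]
  refine mul_nonneg (mul_nonneg zero_le_two (inv_nonneg.2 hr.1.le)) ?_
  have := mul_nonneg hc g2
  linarith

/-! ### The profile Re (x·ν + i x_n)^{3/2} and its gradient -/

/-- The branch cut is harmless: approached from above, the principal logarithm is continuous up to
the negative axis. At 0 the positive real part of s gives continuity. -/
theorem continuousOn_cpow_upper {s : ℂ} (hs : 0 < s.re) :
    ContinuousOn (fun z : ℂ => z ^ s) {z | 0 ≤ z.im} := by
  intro z hz
  by_cases h0 : z = 0
  · subst h0
    have := (Complex.continuousAt_cpow_zero_of_re_pos hs).comp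
      (f := fun z : ℂ => (z, s)) (x := 0) (by fun_prop)
    exact this.continuousWithinAt
  have hlog : ContinuousWithinAt Complex.log {z | 0 ≤ z.im} z := by
    by_cases hsp : z ∈ Complex.slitPlane
    · exact (continuousAt_clog hsp).continuousWithinAt
    · rw [Complex.mem_slitPlane_iff, not_or, not_lt, not_not] at hsp
      refine Complex.continuousWithinAt_log_of_re_neg_of_im_zero (lt_of_le_of_ne hsp.1 ?_) hsp.2
      intro h
      exact h0 (Complex.ext h hsp.2)
  have hexp : ContinuousWithinAt (fun z => Complex.exp (Complex.log z * s)) {z | 0 ≤ z.im} z :=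
    (hlog.mul continuousWithinAt_const).cexp
  refine hexp.congr_of_eventuallyEq ?_ (Complex.cpow_def_of_ne_zero h0 s)
  filter_upwards [mem_nhdsWithin_of_mem_nhds (isOpen_compl_singleton.mem_nhds h0)] with w hw
  exact Complex.cpow_def_of_ne_zero hw s

theorem ofReal_mul_cpow {r : ℝ} (hr : 0 < r) (z : ℂ) {s : ℝ} (hs : s ≠ 0) :
    ((r : ℂ) * z) ^ (s : ℂ) = ((r ^ s : ℝ) : ℂ) * z ^ (s : ℂ) := by
  by_cases hz : z = 0
  · subst hz
    rw [mul_zero, Complex.zero_cpow (by exact_mod_cast hs), mul_zero]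
  have hr' : (r : ℂ) ≠ 0 := by exact_mod_cast hr.ne'
  rw [Complex.cpow_def_of_ne_zero (mul_ne_zero hr' hz), Complex.log_ofReal_mul hr hz, add_mul,
    Complex.exp_add, Complex.cpow_def_of_ne_zero hz, Complex.ofReal_cpow hr.le,
    Complex.cpow_def_of_ne_zero hr', Complex.ofReal_log hr.le]

/-- The complex coordinate `x · ν + i x_n`. -/
def zmap (ν : Space m) : Space m →L[ℝ] ℂ :=
  (innerSL ℝ ν).smulRight (1 : ℂ) +
    (EuclideanSpace.proj (𝕜 := ℝ) (idxN m) : Space m →L[ℝ] ℝ).smulRight Complex.I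

theorem zmap_apply (ν x : Space m) :
    zmap ν x = ((inner ℝ x ν : ℝ) : ℂ) + (x (idxN m) : ℂ) * Complex.I := by
  simp [zmap, real_inner_comm]

theorem zmap_re (ν x : Space m) : (zmap ν x).re = inner ℝ x ν := by simp [zmap_apply]

theorem zmap_im (ν x : Space m) : (zmap ν x).im = x (idxN m) := by simp [zmap_apply]

/-- The vector field `w ↦ Re w · ν - Im w · e_n`. -/
def tmap (ν : Space m) : ℂ →L[ℝ] Space m :=
  Complex.reCLM.smulRight ν - Complex.imCLM.smulRight (EuclideanSpace.single (idxN m) (1 : ℝ))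

theorem tmap_apply (ν : Space m) (w : ℂ) :
    tmap ν w = w.re • ν - w.im • EuclideanSpace.single (idxN m) (1 : ℝ) := by simp [tmap]

/-- The `3/2`-homogeneous profile with normal `ν`. -/
def prof (ν x : Space m) : ℝ := (zmap ν x ^ (3 / 2 : ℂ)).re

/-- The gradient of the profile. -/
def profGrad (ν x : Space m) : Space m := (3 / 2 : ℝ) • tmap ν (zmap ν x ^ (1 / 2 : ℂ))

/-- Consequently the gradient of Re F(`zmap ν x`), F holomorphic, is `tmap ν` applied to F'(`zmap ν
x`). -/
theorem inner_tmap (ν v : Space m) (w : ℂ) : inner ℝ (tmap ν w) v = (w * zmap ν v).re := by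
  rw [tmap_apply, inner_sub_left, inner_smul_left, inner_smul_left, Complex.mul_re, zmap_re,
    zmap_im, real_inner_comm, EuclideanSpace.inner_single_left]
  simp

/-- Euler's identity for a 3/2-homogeneous function, here z^(1/2) z = z^(3/2). -/
theorem inner_profGrad (ν x : Space m) : inner ℝ x (profGrad ν x) = 3 / 2 * prof ν x := by
  rw [profGrad, inner_smul_right, real_inner_comm, inner_tmap, prof]
  congr 2
  by_cases h : zmap ν x = 0
  · rw [h, mul_zero, Complex.zero_cpow (by norm_num)]
  · nth_rewrite 2 [← Complex.cpow_one (zmap ν x)]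
    rw [← Complex.cpow_add _ _ h]
    norm_num

theorem prof_smul (ν x : Space m) {r : ℝ} (hr : 0 < r) :
    prof ν (r • x) = r ^ (3 / 2 : ℝ) * prof ν x := by
  have := ofReal_mul_cpow hr (zmap ν x) (s := 3 / 2) (by norm_num)
  push_cast at this
  rw [prof, prof, map_smul, Complex.real_smul, this, ← Complex.re_ofReal_mul]

theorem zmap_mem_slitPlane {ν x : Space m} (hx : 0 < x (idxN m)) :
    zmap ν x ∈ Complex.slitPlane :=
  Complex.mem_slitPlane_iff.2 (Or.inr (by rw [zmap_im]; exact hx.ne'))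

theorem hasFDerivAt_zmap_cpow {ν x : Space m} (hx : 0 < x (idxN m)) (s : ℂ) :
    HasFDerivAt (fun y => zmap ν y ^ s)
      (((ContinuousLinearMap.mul ℝ ℂ) (s * zmap ν x ^ (s - 1))).comp (zmap ν)) x := by
  have h1 : HasFDerivAt (fun z : ℂ => z ^ s) _ (zmap ν x) :=
    (Complex.hasStrictDerivAt_cpow_const (c := s)
      (zmap_mem_slitPlane hx)).hasDerivAt.complexToReal_fderiv
  refine (h1.comp x (zmap ν).hasFDerivAt).congr_fderiv ?_
  ext v
  simp

theorem contDiffAt_zmap_cpow {ν x : Space m} (hx : 0 < x (idxN m)) (s : ℂ) :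
    ContDiffAt ℝ 1 (fun y => zmap ν y ^ s) x := by
  have h1 : AnalyticAt ℂ (fun z : ℂ => z ^ s) (zmap ν x) :=
    analyticAt_id.cpow analyticAt_const (zmap_mem_slitPlane hx)
  exact (h1.contDiffAt (n := 1)).restrict_scalars ℝ |>.comp x (zmap ν).contDiff.contDiffAt

theorem harmPair_prof {ν : Space m} (hν : ‖ν‖ = 1) (hνn : ν (idxN m) = 0) :
    HarmPair (prof ν) (profGrad ν) where
  cont := by
    refine Complex.continuous_re.comp_continuousOn
      ((continuousOn_cpow_upper (s := 3 / 2) (by norm_num)).comp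
        (zmap ν).continuous.continuousOn fun x hx => ?_)
    rw [mem_ofPred_eq, zmap_im]; exact hx.2
  contGrad := by
    have : ContinuousOn (fun x => tmap ν (zmap ν x ^ (1 / 2 : ℂ))) (closedHalf m 1) := by
      refine (tmap ν).continuous.comp_continuousOn
        ((continuousOn_cpow_upper (s := 1 / 2) (by norm_num)).comp
          (zmap ν).continuous.continuousOn fun x hx => ?_)
      rw [mem_ofPred_eq, zmap_im]; exact hx.2
    exact this.const_smul (3 / 2 : ℝ)
  hasGrad x hx := by
    have h1 := Complex.reCLM.hasFDerivAt.comp x (hasFDerivAt_zmap_cpow (ν := ν) hx.2 (3 / 2))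
    refine h1.congr_fderiv ?_
    ext v
    rw [innerSL_apply_apply, profGrad, inner_smul_left, inner_tmap]
    have : (3 / 2 : ℂ) - 1 = 1 / 2 := by norm_num
    simp only [ContinuousLinearMap.comp_apply, ContinuousLinearMap.mul_apply', this,
      Complex.reCLM_apply, conj_trivial]
    rw [mul_assoc, show (3 / 2 : ℂ) = ((3 / 2 : ℝ) : ℂ) by norm_num, Complex.re_ofReal_mul]
  c1 x hx := by
    have := ((tmap ν).contDiff.contDiffAt.comp x
      (contDiffAt_zmap_cpow (ν := ν) hx.2 (1 / 2))).const_smul (3 / 2 : ℝ)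
    exact this.contDiffWithinAt
  div_zero x hx := by
    have h1 := ((tmap ν).hasFDerivAt.comp x (hasFDerivAt_zmap_cpow (ν := ν) hx.2 (1 / 2)))
    have h2 : HasFDerivAt (fun y => tmap ν (zmap ν y ^ (1 / 2 : ℂ))) _ x := h1
    unfold profGrad
    rw [dvg_const_smul h2.differentiableAt, dvg, h2.fderiv]
    set c : ℂ := 1 / 2 * zmap ν x ^ ((1 / 2 : ℂ) - 1)
    -- Summed over i, the first term is c.re because ‖ν‖ = 1 and cancels the last; the cross term
    -- vanishes because ν has no normal component.
    have h3 : ∀ i : Fin (m + 2), (tmap ν (c * zmap ν (EuclideanSpace.single i 1))) i =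
        c.re * (ν i * ν i) - 2 * c.im * (ν i * (if i = idxN m then 1 else 0)) -
          c.re * (if i = idxN m then 1 else 0) := by
      intro i
      rw [tmap_apply]
      simp only [PiLp.sub_apply, PiLp.smul_apply, Complex.mul_re, Complex.mul_im, zmap_re, zmap_im,
        smul_eq_mul, EuclideanSpace.inner_single_left, PiLp.single_apply]
      by_cases hi : i = idxN m
      · subst hi; simp; ring
      · simp [hi, Ne.symm hi]; ring
    have h4 : ∑ i, ν i * ν i = 1 := by
      have := EuclideanSpace.real_norm_sq_eq ν
      rw [hν] at this
      simpa [sq] using this.symm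
    have h5 : ∀ i, ((((tmap ν).comp (((ContinuousLinearMap.mul ℝ ℂ) c).comp (zmap ν)))
        (EuclideanSpace.single i 1) : Space m) i) =
        (tmap ν (c * zmap ν (EuclideanSpace.single i 1))) i := fun i => rfl
    simp only [h5, h3]
    rw [Finset.sum_sub_distrib, Finset.sum_sub_distrib, ← Finset.mul_sum, h4, ← Finset.mul_sum]
    simp [hνn]

theorem zmap_flat {ν x : Space m} (hx : x (idxN m) = 0) :
    zmap ν x = ((inner ℝ x ν : ℝ) : ℂ) := by simp [zmap_apply, hx]

/-- For t = x·ν ≥ 0 the value is t^(3/2); for t < 0 the argument is π and cos(3π/2) = 0. -/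
theorem prof_flat_nonneg (ν : Space m) {x : Space m} (hx : x (idxN m) = 0) : 0 ≤ prof ν x := by
  rw [prof, zmap_flat hx]
  set t : ℝ := inner ℝ x ν
  rcases le_or_gt 0 t with h | h
  · rw [show (3 / 2 : ℂ) = ((3 / 2 : ℝ) : ℂ) by norm_num, ← Complex.ofReal_cpow h,
      Complex.ofReal_re]
    positivity
  · rw [Complex.ofReal_cpow_of_nonpos h.le, ← Complex.ofReal_neg,
      show (Real.pi : ℂ) * Complex.I * (3 / 2) =
        ((3 * Real.pi / 2 : ℝ) : ℂ) * Complex.I by push_cast; ring,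
      show (3 / 2 : ℂ) = ((3 / 2 : ℝ) : ℂ) by norm_num,
      ← Complex.ofReal_cpow (by linarith), Complex.re_ofReal_mul, Complex.exp_ofReal_mul_I_re]
    have : Real.cos (3 * Real.pi / 2) = 0 := by
      rw [Real.cos_eq_zero_iff]; exact ⟨1, by push_cast; ring⟩
    rw [this, mul_zero]

theorem profGrad_normal {ν : Space m} (hνn : ν (idxN m) = 0) (x : Space m) :
    profGrad ν x (idxN m) = -(3 / 2) * (zmap ν x ^ (1 / 2 : ℂ)).im := by
  simp [profGrad, tmap_apply, hνn]

theorem profGrad_flat_of_nonneg {ν : Space m} (hνn : ν (idxN m) = 0) {x : Space m}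
    (hx : x (idxN m) = 0) (h : 0 ≤ inner ℝ x ν) : profGrad ν x (idxN m) = 0 := by
  rw [profGrad_normal hνn, zmap_flat hx, show (1 / 2 : ℂ) = ((1 / 2 : ℝ) : ℂ) by norm_num,
    ← Complex.ofReal_cpow h, Complex.ofReal_im, mul_zero]

theorem profGrad_flat_ge {ν : Space m} (hν : ‖ν‖ = 1) (hνn : ν (idxN m) = 0) {x : Space m}
    (hx : x (idxN m) = 0) (h1 : ‖x‖ ≤ 1) : -(3 / 2) ≤ profGrad ν x (idxN m) := by
  rw [profGrad_normal hνn, zmap_flat hx, show (1 / 2 : ℂ) = ((1 / 2 : ℝ) : ℂ) by norm_num]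
  have h2 := (Complex.abs_im_le_norm (((inner ℝ x ν : ℝ) : ℂ) ^ ((1 / 2 : ℝ) : ℂ)))
  rw [Complex.norm_cpow_real, Complex.norm_real] at h2
  have h3 : ‖(inner ℝ x ν : ℝ)‖ ≤ 1 :=
    (norm_inner_le_norm x ν).trans (by rw [hν, mul_one]; exact h1)
  have h4 := Real.rpow_le_one (norm_nonneg _) h3 (show (0 : ℝ) ≤ 1 / 2 by norm_num)
  have := (le_abs_self _).trans (h2.trans h4)
  linarith

/-! ### Closed half balls, one-sided derivatives and the Hölder norms -/

/-- The closed half ball centred at a point of `{x_n = 0}`. -/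
theorem closure_halfBall {x₀ : Space m} (h0 : x₀ (idxN m) = 0) {r : ℝ} (hr : 0 < r) :
    closure (halfBall x₀ r) = {x | x ∈ Metric.closedBall x₀ r ∧ 0 ≤ x (idxN m)} := by
  apply Subset.antisymm
  · refine closure_minimal (fun x hx => ⟨Metric.ball_subset_closedBall hx.1, hx.2.le⟩) ?_
    exact Metric.isClosed_closedBall.inter (isClosed_le continuous_const (continuous_coord _))
  · rintro x ⟨hx1, hx2⟩
    set w : Space m := x₀ + (r / 2) • EuclideanSpace.single (idxN m) 1
    have hw : dist w x₀ = r / 2 := by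
      simp [w, dist_eq_norm, norm_smul, abs_of_pos hr]
    have hwn : w (idxN m) = r / 2 := by simp [w, h0]
    have ht : Tendsto (fun t : ℝ => x + t • (w - x)) (𝓝[>] 0) (𝓝 x) := by
      have : Continuous fun t : ℝ => x + t • (w - x) := by fun_prop
      have := (this.tendsto 0).mono_left (nhdsWithin_le_nhds (s := Ioi 0))
      simpa using this
    refine mem_closure_of_tendsto ht ?_
    filter_upwards [Ioo_mem_nhdsGT (zero_lt_one (α := ℝ))] with t ht
    refine ⟨?_, ?_⟩
    · have e : x + t • (w - x) - x₀ = (1 - t) • (x - x₀) + t • (w - x₀) := by module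
      rw [Metric.mem_ball, dist_eq_norm, e]
      refine (norm_add_le _ _).trans_lt ?_
      rw [norm_smul, norm_smul, ← dist_eq_norm x x₀, ← dist_eq_norm w x₀, hw,
        Real.norm_of_nonneg (by linarith [ht.2]), Real.norm_of_nonneg ht.1.le]
      have : dist x x₀ ≤ r := hx1
      have := mul_le_mul_of_nonneg_left this (sub_nonneg.2 ht.2.le)
      nlinarith [ht.1, mul_pos ht.1 hr]
    · have : (x + t • (w - x)) (idxN m) = (1 - t) * x (idxN m) + t * (r / 2) := by
        simp [hwn]; ring
      rw [this]
      have := mul_nonneg (sub_nonneg.2 ht.2.le) hx2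
      have := mul_pos ht.1 (half_pos hr)
      linarith

theorem convex_halfSpace : Convex ℝ {x : Space m | 0 ≤ x (idxN m)} := by
  intro x hx y hy a b ha hb _
  have : 0 ≤ a * x (idxN m) + b * y (idxN m) :=
    add_nonneg (mul_nonneg ha hx) (mul_nonneg hb hy)
  simpa using this

theorem convex_closure_halfBall {x₀ : Space m} (h0 : x₀ (idxN m) = 0) {r : ℝ} (hr : 0 < r) :
    Convex ℝ (closure (halfBall x₀ r)) := by
  rw [closure_halfBall h0 hr]
  exact (convex_closedBall x₀ r).inter convex_halfSpace

theorem halfBall_nonempty {x₀ : Space m} (h0 : x₀ (idxN m) = 0) {r : ℝ} (hr : 0 < r) :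
    (halfBall x₀ r).Nonempty := by
  have : x₀ ∈ closure (halfBall x₀ r) := by
    rw [closure_halfBall h0 hr]; exact ⟨Metric.mem_closedBall_self hr.le, h0.ge⟩
  exact closure_nonempty_iff.1 ⟨_, this⟩

theorem uniqueDiffOn_closure_halfBall {x₀ : Space m} (h0 : x₀ (idxN m) = 0) {r : ℝ} (hr : 0 < r) :
    UniqueDiffOn ℝ (closure (halfBall x₀ r)) :=
  uniqueDiffOn_convex (convex_closure_halfBall h0 hr)
    ((halfBall_nonempty h0 hr).mono (interior_maximal subset_closure (isOpen_halfBall _ _)))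

theorem mem_dom {x : Space m} : x ∈ dom m ↔ ‖x‖ < 2 ∧ 0 ≤ x (idxN m) := by
  simp only [dom, halfBall, flatBall, mem_union, mem_ofPred_eq, mem_ball_zero_iff]
  constructor
  · rintro (h | h)
    · exact ⟨h.1, h.2.le⟩
    · exact ⟨h.1, h.2.ge⟩
  · rintro ⟨h1, h2⟩
    rcases h2.eq_or_lt with h | h
    · exact Or.inr ⟨h1, h.symm⟩
    · exact Or.inl ⟨h1, h⟩

theorem closure_halfBall_subset_dom {x₀ : Space m} (h0 : x₀ (idxN m) = 0) {r : ℝ} (hr : 0 < r)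
    (h : ‖x₀‖ + r < 2) : closure (halfBall x₀ r) ⊆ dom m := by
  rw [closure_halfBall h0 hr]
  rintro x ⟨h1, h2⟩
  rw [mem_dom]
  refine ⟨?_, h2⟩
  have : ‖x‖ ≤ ‖x₀‖ + r := by
    have := norm_add_le x₀ (x - x₀)
    rw [add_sub_cancel, ← dist_eq_norm] at this
    exact this.trans (add_le_add le_rfl h1)
  linarith

/-- Near a point of norm less than r both sets coincide with the half space. So the derivatives
within them agree, which carries the regularity on closed half balls over to `D u`. -/
theorem closure_halfBall_eventuallyEq_dom {x : Space m} {r : ℝ} (hx : ‖x‖ < r) (hr : r < 2) :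
    closure (halfBall (0 : Space m) r) =ᶠ[𝓝 x] dom m := by
  have hr0 : 0 < r := (norm_nonneg x).trans_lt hx
  rw [closure_halfBall (by simp) hr0]
  have : {y : Space m | ‖y‖ < r} ∈ 𝓝 x := (isOpen_lt continuous_norm continuous_const).mem_nhds hx
  refine Filter.eventuallyEq_set.2 ?_
  filter_upwards [this] with y hy
  rw [mem_dom]
  simp only [mem_closedBall_zero_iff]
  have hy' : ‖y‖ < r := hy
  constructor
  · rintro ⟨_, h⟩; exact ⟨by linarith, h⟩
  · rintro ⟨_, h⟩; exact ⟨hy'.le, h⟩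

theorem IsC1HalfLoc.differentiableWithinAt {u : Space m → ℝ} (hu : IsC1HalfLoc u) {x : Space m}
    (hx : x ∈ dom m) : DifferentiableWithinAt ℝ u (dom m) x := by
  obtain ⟨h1, h2⟩ := mem_dom.1 hx
  obtain ⟨r, hr1, hr2⟩ := exists_between h1
  have hr0 : 0 < r := (norm_nonneg x).trans_lt hr1
  have hmem : x ∈ closure (halfBall (0 : Space m) r) := by
    rw [closure_halfBall (by simp) hr0]
    exact ⟨by simpa using hr1.le, h2⟩
  have := (hu r hr0 hr2).1.differentiableOn one_ne_zero x hmem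
  exact (differentiableWithinAt_congr_set (closure_halfBall_eventuallyEq_dom hr1 hr2)).1 this

theorem IsC1HalfLoc.continuousOn_D {u : Space m → ℝ} (hu : IsC1HalfLoc u) :
    ContinuousOn (D u) (dom m) := by
  intro x hx
  obtain ⟨h1, h2⟩ := mem_dom.1 hx
  obtain ⟨r, hr1, hr2⟩ := exists_between h1
  have hr0 : 0 < r := (norm_nonneg x).trans_lt hr1
  have hmem : x ∈ closure (halfBall (0 : Space m) r) := by
    rw [closure_halfBall (by simp) hr0]
    exact ⟨by simpa using hr1.le, h2⟩
  have hc := (hu r hr0 hr2).1.continuousOn_fderivWithin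
    (uniqueDiffOn_closure_halfBall (by simp) hr0) le_rfl x hmem
  have hc' : ContinuousWithinAt (fderivWithin ℝ u (closure (halfBall (0 : Space m) r))) (dom m) x :=
    hc.congr_set (closure_halfBall_eventuallyEq_dom hr1 hr2)
  refine hc'.congr_of_eventuallyEq ?_
    (fderivWithin_congr_set (closure_halfBall_eventuallyEq_dom hr1 hr2).symm)
  have : {y : Space m | ‖y‖ < r} ∈ 𝓝 x := (isOpen_lt continuous_norm continuous_const).mem_nhds hr1
  filter_upwards [mem_nhdsWithin_of_mem_nhds this] with y hy
  exact fderivWithin_congr_set (closure_halfBall_eventuallyEq_dom hy hr2).symm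

theorem IsC1HalfLoc.fderivWithin_closure {u : Space m → ℝ} (hu : IsC1HalfLoc u) {x₀ : Space m}
    (h0 : x₀ (idxN m) = 0) {r : ℝ} (hr : 0 < r) (h : ‖x₀‖ + r < 2) {x : Space m}
    (hx : x ∈ closure (halfBall x₀ r)) :
    fderivWithin ℝ u (closure (halfBall x₀ r)) x = D u x :=
  fderivWithin_subset (closure_halfBall_subset_dom h0 hr h)
    (uniqueDiffOn_closure_halfBall h0 hr x hx)
    (hu.differentiableWithinAt (closure_halfBall_subset_dom h0 hr h hx))

theorem eHolderNorm_domRestrict_mono {X Y : Type*} [MetricSpace X] [MetricSpace Y] (α : ℝ≥0)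
    {g h : X → Y} {s t : Set X} (hst : s ⊆ t) (hgh : EqOn g h s) :
    eHolderNorm α (s.domRestrict g) ≤ eHolderNorm α (t.domRestrict h) := by
  refine le_iInf₂ fun C hC => ?_
  have : HolderWith C α (s.domRestrict g) := fun x y => by
    have := hC ⟨x, hst x.2⟩ ⟨y, hst y.2⟩
    simp only [Set.domRestrict, hgh x.2, hgh y.2]
    exact this
  exact this.eHolderNorm_le

/-- Every half ball concerned lies in the closed half ball of radius 1 + ρ < 2 about 0. The
one-sided derivatives on nested half balls agree by unique differentiability, so each of the three
terms of the norm is monotone. -/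
theorem IsC1HalfLoc.exists_halfBallBound {u : Space m → ℝ} (hu : IsC1HalfLoc u) {ρ : ℝ}
    (hρ : ρ < 1) : ∃ Cu : ℝ≥0, ∀ x₀ ∈ flatBall (0 : Space m) ρ, HalfBallBound u x₀ Cu := by
  rcases le_or_gt ρ 0 with hρ0 | hρ0
  · refine ⟨0, fun x₀ hx₀ => ?_⟩
    have := mem_ball_zero_iff.1 hx₀.1
    linarith [norm_nonneg x₀]
  have hR0 : 0 < 1 + ρ := by linarith
  have hR2 : 1 + ρ < 2 := by linarith
  have hfin := (hu (1 + ρ) hR0 hR2).2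
  refine ⟨(c1HolderNorm (1 / 2) u (closure (halfBall 0 (1 + ρ)))).toNNReal,
    fun x₀ hx₀ r hr0 hr1 => ?_⟩
  rw [ENNReal.coe_toNNReal hfin.ne]
  have hn := mem_ball_zero_iff.1 hx₀.1
  have hsub : closure (halfBall x₀ r) ⊆ closure (halfBall 0 (1 + ρ)) := by
    refine closure_mono fun x hx => ⟨?_, hx.2⟩
    refine Metric.ball_subset_ball' ?_ hx.1
    rw [dist_zero_right]; linarith
  have he : EqOn (fderivWithin ℝ u (closure (halfBall x₀ r)))
      (fderivWithin ℝ u (closure (halfBall 0 (1 + ρ)))) (closure (halfBall x₀ r)) := fun x hx => by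
    rw [hu.fderivWithin_closure hx₀.2 hr0 (by linarith) hx,
      hu.fderivWithin_closure (by simp) hR0 (by simpa using hR2) (hsub hx)]
  refine add_le_add (add_le_add (iSup_le_iSup_of_subset hsub) ?_) ?_
  · refine iSup₂_le fun x hx => ?_
    rw [he hx]
    exact le_iSup₂_of_le x (hsub hx) le_rfl
  · exact eHolderNorm_domRestrict_mono _ hsub he

theorem norm_sub_le_of_eHolderNorm_le {V W : Type*} [NormedAddCommGroup V] [NormedAddCommGroup W]
    {α K : ℝ≥0} {g : V → W} {S : Set V} (h : eHolderNorm α (S.domRestrict g) ≤ K) {x y : V}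
    (hx : x ∈ S) (hy : y ∈ S) : ‖g x - g y‖ ≤ K * ‖x - y‖ ^ (α : ℝ) := by
  have hm : MemHolder α (S.domRestrict g) :=
    eHolderNorm_lt_top.1 (h.trans_lt ENNReal.coe_lt_top)
  have h1 := hm.holderWith.dist_le ⟨x, hx⟩ ⟨y, hy⟩
  have h2 : nnHolderNorm α (S.domRestrict g) ≤ K := by
    have := (coe_nnHolderNorm_le_eHolderNorm (r := α) (f := S.domRestrict g)).trans h
    exact_mod_cast this
  rw [Subtype.dist_eq, dist_eq_norm, dist_eq_norm] at h1
  refine h1.trans (mul_le_mul_of_nonneg_right (by exact_mod_cast h2) (by positivity))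

theorem eHolderNorm_le_c1HolderNorm {V : Type*} [NormedAddCommGroup V] [NormedSpace ℝ V]
    (α : ℝ≥0) (g : V → ℝ) (S : Set V) :
    eHolderNorm α (S.domRestrict (fderivWithin ℝ g S)) ≤ c1HolderNorm α g S := le_add_self

/-! ### Translating the solution to a free boundary point -/

/-- The translate of `u` to the centre `x₀`. -/
def transl (u : Space m → ℝ) (x₀ x : Space m) : ℝ := u (x₀ + x)

/-- The gradient of the translate, up to the flat boundary. -/
def translGrad (u : Space m → ℝ) (x₀ x : Space m) : Space m :=
  (InnerProductSpace.toDual ℝ (Space m)).symm (D u (x₀ + x))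

theorem inner_translGrad (u : Space m → ℝ) (x₀ x v : Space m) :
    inner ℝ (translGrad u x₀ x) v = D u (x₀ + x) v := by
  simp [translGrad]

theorem norm_translGrad (u : Space m → ℝ) (x₀ x : Space m) :
    ‖translGrad u x₀ x‖ = ‖D u (x₀ + x)‖ := by
  simp [translGrad]

theorem translGrad_apply (u : Space m → ℝ) (x₀ x : Space m) (i : Fin (m + 2)) :
    translGrad u x₀ x i = pd i u (x₀ + x) := by
  have := inner_translGrad u x₀ x (EuclideanSpace.single i 1)
  rw [EuclideanSpace.inner_single_right] at this
  simpa [pd] using this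

theorem add_mem_dom {x₀ : Space m} (hx₀ : x₀ ∈ flatBall (0 : Space m) 1) {x : Space m}
    (hx : x ∈ halfDom m) : x₀ + x ∈ dom m := by
  rw [mem_dom]
  have h1 := mem_ball_zero_iff.1 hx₀.1
  have h2 : x₀ (idxN m) = 0 := hx₀.2
  refine ⟨(norm_add_le _ _).trans_lt (by linarith [hx.1]), ?_⟩
  simpa [h2] using hx.2

theorem add_mem_halfBall_two {x₀ : Space m} (hx₀ : x₀ ∈ flatBall (0 : Space m) 1) {x : Space m}
    (hx : x ∈ halfBall (0 : Space m) 1) : x₀ + x ∈ halfBall (0 : Space m) 2 := by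
  have h1 := mem_ball_zero_iff.1 hx₀.1
  have h3 := mem_ball_zero_iff.1 hx.1
  have h2 : x₀ (idxN m) = 0 := hx₀.2
  refine ⟨mem_ball_zero_iff.2 ((norm_add_le _ _).trans_lt (by linarith)), ?_⟩
  simpa [h2] using hx.2

theorem D_eq_fderiv (u : Space m → ℝ) {x : Space m} (hx : x ∈ halfBall (0 : Space m) 2) :
    D u x = fderiv ℝ u x :=
  fderivWithin_of_mem_nhds (mem_of_superset ((isOpen_halfBall _ _).mem_nhds hx) subset_union_left)

theorem add_mem_flatBall_two {x₀ : Space m} (hx₀ : x₀ ∈ flatBall (0 : Space m) 1) {x : Space m}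
    (hx : x ∈ halfDom m) (hn : x (idxN m) = 0) : x₀ + x ∈ flatBall (0 : Space m) 2 := by
  have h2 : x₀ (idxN m) = 0 := hx₀.2
  exact ⟨mem_ball_zero_iff.2 (mem_dom.1 (add_mem_dom hx₀ hx)).1, by simp [h2, hn]⟩

theorem sigData_transl {u : Space m → ℝ} (hs : IsSolution u) (hu : IsC1HalfLoc u) {x₀ : Space m}
    (hx₀ : x₀ ∈ flatBall (0 : Space m) 1) : SigData (transl u x₀) (translGrad u x₀) := by
  have hfd : ∀ x ∈ halfBall (0 : Space m) 1, translGrad u x₀ =ᶠ[𝓝 x]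
      fun y => (InnerProductSpace.toDual ℝ (Space m)).symm (fderiv ℝ u (x₀ + y)) := fun x hx => by
    filter_upwards [(isOpen_halfBall _ _).mem_nhds hx] with y hy
    rw [translGrad, D_eq_fderiv u (add_mem_halfBall_two hx₀ hy)]
  have hcd : ∀ x ∈ halfBall (0 : Space m) 1, ContDiffAt ℝ 1 (fderiv ℝ u) (x₀ + x) := fun x hx =>
    (hs.harmonic _ (add_mem_halfBall_two hx₀ hx)).1.fderiv_right (by norm_num)
  refine ⟨fun x hx => ?_, ?_, fun x hx => ?_, fun x hx => ?_, fun x hx hn => ?_,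
    fun x hx hn => ?_, fun x hx hn => ?_⟩
  · have h1 := (hu.differentiableWithinAt (add_mem_dom hx₀ hx)).hasFDerivWithinAt
    have h2 : HasFDerivWithinAt (fun y : Space m => x₀ + y) (ContinuousLinearMap.id ℝ (Space m))
        (halfDom m) x := (hasFDerivWithinAt_id x _).const_add x₀
    have h3 := h1.comp x h2 fun y hy => add_mem_dom hx₀ hy
    refine h3.congr_fderiv ?_
    ext v
    rw [innerSL_apply_apply, inner_translGrad]
    rfl
  · exact (InnerProductSpace.toDual ℝ (Space m)).symm.continuous.comp_continuousOn
      (hu.continuousOn_D.comp (by fun_prop) fun x hx => add_mem_dom hx₀ hx)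
  · refine (ContDiffAt.congr_of_eventuallyEq ?_ (hfd x hx)).contDiffWithinAt
    have h1 : ContDiffAt ℝ 1 (fun y : Space m => x₀ + y) x := by fun_prop
    exact ((InnerProductSpace.toDual ℝ (Space m)).symm.contDiff.contDiffAt).comp x
      ((hcd x hx).comp x h1)
  · have h1 : HasFDerivAt (fun y : Space m => x₀ + y) (ContinuousLinearMap.id ℝ (Space m)) x :=
      (hasFDerivAt_id x).const_add x₀
    have h2 := ((hcd x hx).differentiableAt one_ne_zero).hasFDerivAt.comp x h1
    have h3 := (((InnerProductSpace.toDual ℝ (Space m)).symm.toContinuousLinearEquiv.toContinuousLinearMap).hasFDerivAt.comp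
      x h2).congr_of_eventuallyEq (hfd x hx)
    rw [dvg, h3.fderiv]
    -- The divergence of the gradient is the Laplacian, expanded in the standard orthonormal basis.
    have hlap := (hs.harmonic _ (add_mem_halfBall_two hx₀ hx)).2.self_of_nhds
    rw [InnerProductSpace.laplacian_eq_iteratedFDeriv_orthonormalBasis u
      (EuclideanSpace.basisFun (Fin (m + 2)) ℝ)] at hlap
    simp only [iteratedFDeriv_two_apply, Pi.zero_apply] at hlap
    rw [← hlap]
    refine Finset.sum_congr rfl fun i _ => ?_
    set T := fderiv ℝ (fderiv ℝ u) (x₀ + x) (EuclideanSpace.single i 1)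
    have : (InnerProductSpace.toDual ℝ (Space m)).symm T i = T (EuclideanSpace.single i 1) := by
      have h := InnerProductSpace.toDual_symm_apply (𝕜 := ℝ) (x := EuclideanSpace.single i 1) (y := T)
      rw [EuclideanSpace.inner_single_right] at h
      simpa using h
    simpa using this
  · exact hs.nonneg _ (add_mem_flatBall_two hx₀ hx hn)
  · rw [translGrad_apply]
    linarith [hs.normal_nonneg _ (add_mem_flatBall_two hx₀ hx hn)]
  · rw [translGrad_apply]
    exact hs.compl _ (add_mem_flatBall_two hx₀ hx hn)

/-! ### The normal to the free boundary and the Taylor estimate -/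

theorem inner_outerNormal (f : EuclideanSpace ℝ (Fin m) → ℝ) (x₀ x : Space m) :
    inner ℝ x (outerNormal f x₀) = (Real.sqrt (1 + ‖gradient f (proj x₀)‖ ^ 2))⁻¹ *
      (x (idxN1 m) - inner ℝ (gradient f (proj x₀)) (proj x)) := by
  rw [outerNormal, inner_smul_right]
  congr 1
  rw [PiLp.inner_apply, PiLp.inner_apply, Fin.sum_univ_castSucc, Fin.sum_univ_castSucc]
  simp [proj, idxN1, Finset.sum_neg_distrib, mul_comm]
  ring

theorem outerNormal_last (f : EuclideanSpace ℝ (Fin m) → ℝ) (x₀ : Space m) :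
    outerNormal f x₀ (idxN m) = 0 := by
  simp [outerNormal, idxN]

theorem norm_outerNormal (f : EuclideanSpace ℝ (Fin m) → ℝ) (x₀ : Space m) :
    ‖outerNormal f x₀‖ = 1 := by
  set g := gradient f (proj x₀)
  have hpos : 0 < 1 + ‖g‖ ^ 2 := by positivity
  have h1 : ‖(WithLp.toLp 2 (Fin.snoc (α := fun _ => ℝ)
      (Fin.snoc (α := fun _ => ℝ) (fun i : Fin m => -g i) 1) 0) : Space m)‖ =
      Real.sqrt (1 + ‖g‖ ^ 2) := by
    rw [EuclideanSpace.norm_eq, EuclideanSpace.real_norm_sq_eq, Fin.sum_univ_castSucc,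
      Fin.sum_univ_castSucc]
    simp [add_comm]
  rw [outerNormal, norm_smul, h1, Real.norm_of_nonneg (by positivity)]
  exact inv_mul_cancel₀ (Real.sqrt_pos.2 hpos).ne'

theorem norm_proj_le (x : Space m) : ‖proj x‖ ≤ ‖x‖ := by
  rw [EuclideanSpace.norm_eq, EuclideanSpace.norm_eq, Fin.sum_univ_castSucc (n := m + 1),
    Fin.sum_univ_castSucc]
  refine Real.sqrt_le_sqrt ?_
  simp only [proj]
  have h1 := sq_nonneg ‖x (Fin.last m).castSucc‖
  have h2 := sq_nonneg ‖x (Fin.last (m + 1))‖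
  linarith

theorem proj_sub (x y : Space m) : proj (x - y) = proj x - proj y := by
  ext i; simp [proj]

/-- First order Taylor estimate for a function of class `C^{1,α}` on a ball. -/
theorem MemC1Holder.taylor {V : Type*} [NormedAddCommGroup V] [InnerProductSpace ℝ V]
    [CompleteSpace V] {α L : ℝ≥0} {f : V → ℝ} {R : ℝ}
    (hf : MemC1Holder α f (Metric.closedBall 0 R)) (hL : c1HolderNorm α f (Metric.closedBall 0 R) ≤ L)
    {a b : V} (ha : ‖a‖ < R) (hb : ‖b‖ ≤ R) :
    |f b - f a - inner ℝ (gradient f a) (b - a)| ≤ L * ‖b - a‖ ^ (1 + α : ℝ) := by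
  set S : Set V := Metric.closedBall 0 R
  have haS : a ∈ S := mem_closedBall_zero_iff.2 ha.le
  have hbS : b ∈ S := mem_closedBall_zero_iff.2 hb
  have hgrad : fderivWithin ℝ f S a = fderiv ℝ f a :=
    fderivWithin_of_mem_nhds (mem_of_superset (Metric.isOpen_ball.mem_nhds
      (mem_ball_zero_iff.2 ha)) Metric.ball_subset_closedBall)
  -- A convex set containing a and b on which the derivative differs from its value at a by at most
  -- L ‖b - a‖^α.
  set T : Set V := S ∩ Metric.closedBall a ‖b - a‖
  have hd : ∀ x ∈ T, HasFDerivWithinAt f (fderivWithin ℝ f S x) T x := fun x hx =>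
    ((hf.1.differentiableOn one_ne_zero x hx.1).hasFDerivWithinAt).mono inter_subset_left
  have hconv : Convex ℝ T := (convex_closedBall _ _).inter (convex_closedBall _ _)
  have hbound : ∀ x ∈ T, ‖fderivWithin ℝ f S x - fderivWithin ℝ f S a‖ ≤ L * ‖b - a‖ ^ (α : ℝ) := by
    intro x hx
    refine (norm_sub_le_of_eHolderNorm_le ((eHolderNorm_le_c1HolderNorm α f S).trans hL)
      hx.1 haS).trans ?_
    have : ‖x - a‖ ≤ ‖b - a‖ := by rw [← dist_eq_norm]; exact hx.2
    gcongr
  have haT : a ∈ T := ⟨haS, Metric.mem_closedBall_self (norm_nonneg _)⟩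
  have hbT : b ∈ T := ⟨hbS, by rw [Metric.mem_closedBall, dist_eq_norm]⟩
  have h := hconv.norm_image_sub_le_of_norm_hasFDerivWithin_le' hd hbound haT hbT
  rw [hgrad] at h
  have hg : inner ℝ (gradient f a) (b - a) = fderiv ℝ f a (b - a) := by simp [gradient]
  rw [hg, ← Real.norm_eq_abs]
  refine h.trans (le_of_eq ?_)
  rcases (norm_nonneg (b - a)).eq_or_lt with h0 | h0
  · have : (1 + α : ℝ) ≠ 0 := by have := α.2; linarith
    rw [← h0, Real.zero_rpow this, mul_zero, mul_zero]
  · rw [Real.rpow_add h0, Real.rpow_one]; ring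

/-! ### Growth of the solution at a free boundary point -/

section

variable {α : ℝ≥0} {u : Space m → ℝ} {f : EuclideanSpace ℝ (Fin m) → ℝ} {x₀ : Space m}

theorem StandingAssumptions.eq_zero_of_mem (h : StandingAssumptions α u f)
    (hx₀ : x₀ ∈ freeBoundary u) : u x₀ = 0 := by
  have h1 := h.freeBoundary_eq ▸ hx₀
  have h2 : x₀ ∈ coincidenceSet u := by rw [h.coincidence_eq]; exact ⟨h1.1, h1.2.le⟩
  exact h2.2

/-- The normal derivative vanishes on the free boundary by assumption. The tangential ones vanish
because u ≥ 0 on the flat ball and u(x₀) = 0. -/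
theorem StandingAssumptions.translGrad_zero (h : StandingAssumptions α u f)
    (hx₀ : x₀ ∈ freeBoundary u ∩ flatBall 0 1) : translGrad u x₀ 0 = 0 := by
  have hS := sigData_transl h.solution h.u_mem hx₀.2
  have h00 : (0 : Space m) ∈ halfDom m := ⟨by simp, by simp⟩
  ext i
  by_cases hi : i = idxN m
  · subst hi
    rw [translGrad_apply, add_zero]
    exact h.normal_zero x₀ (Or.inr hx₀.1)
  have hflat : ∀ t : ℝ, (t • EuclideanSpace.single i (1 : ℝ) : Space m) (idxN m) = 0 := by
    intro t; simp [Ne.symm hi]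
  have hev : ∀ᶠ t : ℝ in 𝓝 0, (t • EuclideanSpace.single i (1 : ℝ) : Space m) ∈ halfDom m := by
    filter_upwards [Ioo_mem_nhds (show (-1 : ℝ) < 0 by norm_num) zero_lt_one] with t ht
    refine ⟨?_, (hflat t).ge⟩
    simpa [norm_smul, abs_lt] using ht
  have h1 : HasDerivAt (fun t : ℝ => t • (EuclideanSpace.single i (1 : ℝ) : Space m))
      (EuclideanSpace.single i (1 : ℝ)) 0 := by
    simpa using (hasDerivAt_id (0 : ℝ)).smul_const (EuclideanSpace.single i (1 : ℝ) : Space m)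
  have h2 : HasFDerivWithinAt (transl u x₀) (innerSL ℝ (translGrad u x₀ 0)) (halfDom m)
      ((0 : ℝ) • (EuclideanSpace.single i (1 : ℝ) : Space m)) := by
    rw [zero_smul]; exact hS.hasGrad 0 h00
  have h3 := h2.comp_hasDerivAt (0 : ℝ) h1 hev
  have hmin : IsLocalMin (transl u x₀ ∘ fun t : ℝ => t • (EuclideanSpace.single i (1 : ℝ) : Space m))
      0 := by
    filter_upwards [hev] with t ht
    have e : transl u x₀ 0 = 0 := by simp [transl, h.eq_zero_of_mem hx₀.1]
    simp only [Function.comp_apply, zero_smul, e]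
    exact hS.nonneg _ ht (hflat t)
  have := hmin.hasDerivAt_eq_zero h3
  rw [innerSL_apply_apply, EuclideanSpace.inner_single_right] at this
  simpa using this

/-- The Hölder-1/2 bound on the gradient, measured from its zero x₀. -/
theorem StandingAssumptions.norm_translGrad_le (h : StandingAssumptions α u f)
    (hx₀ : x₀ ∈ freeBoundary u ∩ flatBall 0 1) {K : ℝ≥0} (hK : HalfBallBound u x₀ K) {x : Space m}
    (hx : x ∈ halfDom m) : ‖translGrad u x₀ x‖ ≤ K * ‖x‖ ^ (1 / 2 : ℝ) := by
  obtain ⟨r, hr1, hr2⟩ := exists_between hx.1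
  have hr0 : 0 < r := (norm_nonneg x).trans_lt hr1
  have hn := mem_ball_zero_iff.1 hx₀.2.1
  have h0 : x₀ (idxN m) = 0 := hx₀.2.2
  have m1 : x₀ + x ∈ closure (halfBall x₀ r) := by
    rw [closure_halfBall h0 hr0]
    exact ⟨by simpa using hr1.le, by simpa [h0] using hx.2⟩
  have m0 : x₀ ∈ closure (halfBall x₀ r) := by
    rw [closure_halfBall h0 hr0]
    exact ⟨Metric.mem_closedBall_self hr0.le, h0.ge⟩
  have h1 := norm_sub_le_of_eHolderNorm_le ((eHolderNorm_le_c1HolderNorm _ _ _).trans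
    (hK r hr0 hr2)) m1 m0
  rw [h.u_mem.fderivWithin_closure h0 hr0 (by linarith) m1,
    h.u_mem.fderivWithin_closure h0 hr0 (by linarith) m0] at h1
  have hD : D u x₀ = 0 := by
    have h2 := norm_translGrad u x₀ 0
    rw [h.translGrad_zero hx₀, norm_zero, add_zero] at h2
    exact norm_eq_zero.1 h2.symm
  rw [hD, sub_zero, add_sub_cancel_left] at h1
  rw [norm_translGrad]
  simpa using h1

theorem StandingAssumptions.abs_transl_sub_le (h : StandingAssumptions α u f)
    (hx₀ : x₀ ∈ freeBoundary u ∩ flatBall 0 1) {K : ℝ≥0} (hK : HalfBallBound u x₀ K) {ρ : ℝ}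
    (hρ : ρ < 1) {x y : Space m} (hx : x ∈ closedHalf m ρ) (hy : y ∈ closedHalf m ρ) :
    |transl u x₀ x - transl u x₀ y| ≤ K * ρ ^ (1 / 2 : ℝ) * ‖x - y‖ := by
  have hS := sigData_transl h.solution h.u_mem hx₀.2
  have hsub : closedHalf m ρ ⊆ halfDom m := fun z hz => ⟨hz.1.trans_lt hρ, hz.2⟩
  have hconv : Convex ℝ (closedHalf m ρ) := by
    have : closedHalf m ρ = Metric.closedBall 0 ρ ∩ {x | 0 ≤ x (idxN m)} := by
      ext x; simp [closedHalf]
    rw [this]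
    exact (convex_closedBall _ _).inter convex_halfSpace
  have := hconv.norm_image_sub_le_of_norm_hasFDerivWithin_le (𝕜 := ℝ) (f := transl u x₀)
    (f' := fun z => innerSL ℝ (translGrad u x₀ z)) (C := K * ρ ^ (1 / 2 : ℝ))
    (fun z hz => (hS.hasGrad z (hsub hz)).mono hsub) (fun z hz => ?_) hy hx
  · exact this
  · rw [innerSL_apply_norm]
    refine (h.norm_translGrad_le hx₀ hK (hsub hz)).trans ?_
    have := hz.1
    gcongr

theorem StandingAssumptions.abs_transl_le (h : StandingAssumptions α u f)
    (hx₀ : x₀ ∈ freeBoundary u ∩ flatBall 0 1) {K : ℝ≥0} (hK : HalfBallBound u x₀ K) {ρ : ℝ}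
    (hρ0 : 0 < ρ) (hρ : ρ < 1) {x : Space m} (hx : x ∈ closedHalf m ρ) :
    |transl u x₀ x| ≤ K * ρ ^ (3 / 2 : ℝ) := by
  have h1 := h.abs_transl_sub_le hx₀ hK hρ hx (y := 0) ⟨by simpa using hρ0.le, by simp⟩
  have e : transl u x₀ 0 = 0 := by simp [transl, h.eq_zero_of_mem hx₀.1]
  rw [e, sub_zero, sub_zero] at h1
  refine h1.trans ?_
  rw [show (3 / 2 : ℝ) = 1 / 2 + 1 by norm_num, Real.rpow_add hρ0, Real.rpow_one, ← mul_assoc]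
  exact mul_le_mul_of_nonneg_left hx.1 (by positivity)

/-- On the side of the tangent plane of the free boundary where the profile vanishes, the solution
is of higher order. -/
theorem StandingAssumptions.transl_le_of_inner_neg (h : StandingAssumptions α u f) (hα : 0 < α)
    (hα1 : α ≤ 1) {L : ℝ≥0} (hL : c1HolderNorm α f (Metric.closedBall 0 2) ≤ L)
    (hx₀ : x₀ ∈ freeBoundary u ∩ flatBall 0 1) {K : ℝ≥0} (hK : HalfBallBound u x₀ K) {r : ℝ}
    (hr : r ∈ Ioo (0 : ℝ) 1) {x : Space m} (hx : x ∈ closedHalf m r) (hxn : x (idxN m) = 0)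
    (hneg : inner ℝ x (outerNormal f x₀) < 0) :
    transl u x₀ x ≤ 2 * K * (1 + L) * r ^ (3 / 2 + α : ℝ) := by
  have hr0 := hr.1
  have hpos : 0 ≤ 2 * K * (1 + L) * r ^ (3 / 2 + α : ℝ) := by positivity
  have hK0 : (0 : ℝ) ≤ K := K.2
  have hL0 : (0 : ℝ) ≤ L := L.2
  have hrr : r ^ (3 / 2 + α : ℝ) = r ^ (3 / 2 : ℝ) * r ^ (α : ℝ) := Real.rpow_add hr0 _ _
  have h32 : (0 : ℝ) ≤ r ^ (3 / 2 : ℝ) := by positivity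
  have hcrude := (le_abs_self _).trans (h.abs_transl_le hx₀ hK hr0 hr.2 hx)
  -- When r^α is bounded below, the crude growth K r^(3/2) already suffices.
  have key : ∀ c : ℝ, 1 ≤ c * r ^ (α : ℝ) → 0 ≤ c → c ≤ 2 * (1 + L) →
      transl u x₀ x ≤ 2 * K * (1 + L) * r ^ (3 / 2 + α : ℝ) := by
    intro c hc hc0 hc1
    refine hcrude.trans ?_
    rw [hrr]
    have e1 : (K : ℝ) * r ^ (3 / 2 : ℝ) * 1 ≤ K * r ^ (3 / 2 : ℝ) * (c * r ^ (α : ℝ)) :=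
      mul_le_mul_of_nonneg_left hc (by positivity)
    have e2 : (K : ℝ) * r ^ (3 / 2 : ℝ) * r ^ (α : ℝ) * c ≤
        K * r ^ (3 / 2 : ℝ) * r ^ (α : ℝ) * (2 * (1 + L)) :=
      mul_le_mul_of_nonneg_left hc1 (by positivity)
    nlinarith
  have hn0 := mem_ball_zero_iff.1 hx₀.2.1
  have h00 : x₀ (idxN m) = 0 := hx₀.2.2
  rcases le_or_gt (transl u x₀ x) 0 with hu0 | hu0
  · exact hu0.trans hpos
  have hxflat : x₀ + x ∈ flatBall (0 : Space m) 2 :=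
    add_mem_flatBall_two hx₀.2 ⟨hx.1.trans_lt hr.2, hx.2⟩ hxn
  set y := x₀ + x
  have hy2 := mem_ball_zero_iff.1 hxflat.1
  have hx₀f : x₀ (idxN1 m) = f (proj x₀) := (h.freeBoundary_eq ▸ hx₀.1 :).2
  -- The height of the point above the contact set in the direction e_{n-1}. Being below the tangent
  -- plane, it satisfies t ≤ L r^(1+α) by Taylor's formula.
  set t := y (idxN1 m) - f (proj y)
  have ht0 : 0 < t := by
    by_contra hc
    push Not at hc
    have : y ∈ coincidenceSet u := by
      rw [h.coincidence_eq]; exact ⟨hxflat, sub_nonpos.1 hc⟩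
    exact hu0.ne' this.2
  have htay := h.f_mem.taylor hL (a := proj x₀) (b := proj y)
    ((norm_proj_le x₀).trans_lt (by linarith)) ((norm_proj_le y).trans hy2.le)
  have hpx : proj y - proj x₀ = proj x := by rw [← proj_sub]; simp [y]
  rw [hpx] at htay
  have htL : t ≤ L * r ^ (1 + α : ℝ) := by
    rw [inner_outerNormal] at hneg
    have hsq : 0 < (Real.sqrt (1 + ‖gradient f (proj x₀)‖ ^ 2))⁻¹ := by positivity
    have h1 : x (idxN1 m) - inner ℝ (gradient f (proj x₀)) (proj x) < 0 := by
      by_contra hc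
      push Not at hc
      exact absurd hneg (not_lt.2 (mul_nonneg hsq.le hc))
    have h2 : ‖proj x‖ ^ (1 + α : ℝ) ≤ r ^ (1 + α : ℝ) := by
      have := (norm_proj_le x).trans hx.1
      gcongr
    have h3 := (abs_le.1 htay).1
    have h4 : y (idxN1 m) = f (proj x₀) + x (idxN1 m) := by simp [y, hx₀f]
    have h5 := mul_le_mul_of_nonneg_left h2 hL0
    simp only [t]
    linarith
  -- The shifted point below must stay in the half ball of radius 2r < 1. The cases r ≥ 1/2 and t ≥
  -- r are settled by the crude bound, since r^α ≥ 1/2, respectively L r^α ≥ 1.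
  rcases le_or_gt (1 / 2) r with hr2 | hr2
  · refine key 2 ?_ zero_le_two (by linarith)
    have h1 : r ^ (1 : ℝ) ≤ r ^ (α : ℝ) :=
      Real.rpow_le_rpow_of_exponent_ge hr0 hr.2.le (by exact_mod_cast hα1)
    rw [Real.rpow_one] at h1
    linarith
  rcases le_or_gt r t with htr | htr
  · refine key L ?_ hL0 (by linarith)
    have h1 : r ≤ L * r ^ (1 + α : ℝ) := htr.trans htL
    rw [Real.rpow_add hr0, Real.rpow_one] at h1
    have : r * 1 ≤ r * (L * r ^ (α : ℝ)) := by linarith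
    exact le_of_mul_le_mul_left this hr0
  set e : Space m := EuclideanSpace.single (idxN1 m) 1
  have hne : idxN1 m ≠ idxN m := by
    simp [idxN1, idxN, Fin.ext_iff]
  -- Moving down by t lands on the graph of f, where u = 0. The gradient bound K (2r)^(1/2) along
  -- the segment then gives the estimate.
  set z := x - t • e
  have hzn : z (idxN m) = 0 := by simp [z, e, hxn, hne.symm]
  have hte : ‖t • e‖ = t := by simp [e, norm_smul, abs_of_pos ht0]
  have hz : z ∈ closedHalf m (2 * r) := by
    refine ⟨(norm_sub_le _ _).trans ?_, hzn.ge⟩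
    rw [hte]; linarith [hx.1]
  have hzflat : x₀ + z ∈ flatBall (0 : Space m) 2 :=
    add_mem_flatBall_two hx₀.2 ⟨hz.1.trans_lt (by linarith), hz.2⟩ hzn
  have hz0 : transl u x₀ z = 0 := by
    have hpz : proj (x₀ + z) = proj y := by
      ext i
      have hi : i.castSucc.castSucc ≠ idxN1 m := by
        simp [idxN1, Fin.ext_iff, i.2.ne]
      simp [proj, y, z, e, hi]
    have : x₀ + z ∈ coincidenceSet u := by
      rw [h.coincidence_eq]
      refine ⟨hzflat, ?_⟩
      rw [hpz]
      have : (x₀ + z) (idxN1 m) = y (idxN1 m) - t := by simp [y, z, e]; ring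
      rw [this]
      simp [t]
    exact this.2
  have hfin := h.abs_transl_sub_le hx₀ hK (ρ := 2 * r) (by linarith)
    (closedHalf_mono (by linarith) hx) hz
  rw [hz0, sub_zero, show x - z = t • e by simp [z], hte] at hfin
  have h2r : (2 * r) ^ (1 / 2 : ℝ) ≤ 2 * r ^ (1 / 2 : ℝ) := by
    rw [Real.mul_rpow zero_le_two hr0.le]
    refine mul_le_mul_of_nonneg_right ?_ (by positivity)
    have := Real.rpow_le_rpow_of_exponent_le (show (1 : ℝ) ≤ 2 by norm_num)
      (show (1 / 2 : ℝ) ≤ 1 by norm_num)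
    rwa [Real.rpow_one] at this
  calc transl u x₀ x ≤ K * (2 * r) ^ (1 / 2 : ℝ) * t := (le_abs_self _).trans hfin
    _ ≤ K * (2 * r ^ (1 / 2 : ℝ)) * (L * r ^ (1 + α : ℝ)) := by gcongr
    _ = 2 * K * L * r ^ (3 / 2 + α : ℝ) := by
        rw [show (3 / 2 + α : ℝ) = 1 / 2 + (1 + α) by ring, Real.rpow_add hr0 (1 / 2)]; ring
    _ ≤ 2 * K * (1 + L) * r ^ (3 / 2 + α : ℝ) := by gcongr; linarith

/-! ### Frequency, Weiss energy and Monneau functional after rescaling -/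

theorem hemiIntegral_eq (x₀ : Space m) (r : ℝ) (g : Space m → ℝ) :
    hemiIntegral x₀ r g = r ^ (m + 1) * ∫ ω in hemi m, g (x₀ + r • (ω : Space m)) ∂(sph m) := rfl

theorem setIntegral_halfBall_scale (h0 : x₀ (idxN m) = 0) {r : ℝ} (hr : 0 < r) (g : Space m → ℝ) :
    ∫ x in halfBall x₀ r, g x = r ^ (m + 2) * ∫ x in halfBall (0 : Space m) 1, g (x₀ + r • x) := by
  have hO : ∀ (y : Space m) (s : ℝ), MeasurableSet (halfBall y s) :=
    fun y s => (isOpen_halfBall y s).measurableSet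
  rw [← integral_indicator (hO _ _), ← integral_indicator (hO _ _),
    ← integral_add_left_eq_self _ x₀]
  have h1 := Measure.integral_comp_smul_of_nonneg (volume : Measure (Space m))
    (fun y => (halfBall x₀ r).indicator g (x₀ + y)) r (hR := hr.le)
  have h2 : ∀ x, (halfBall (0 : Space m) 1).indicator (fun x => g (x₀ + r • x)) x =
      (halfBall x₀ r).indicator g (x₀ + r • x) := by
    intro x
    have hiff : x ∈ halfBall (0 : Space m) 1 ↔ x₀ + r • x ∈ halfBall x₀ r := by
      simp only [halfBall, mem_ofPred_eq, Metric.mem_ball, dist_zero_right, dist_self_add_left,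
        norm_smul, Real.norm_of_nonneg hr.le, PiLp.add_apply, PiLp.smul_apply, smul_eq_mul, h0,
        zero_add]
      exact and_congr (by rw [mul_lt_iff_lt_one_right hr]) (by rw [mul_pos_iff_of_pos_left hr])
    by_cases hx : x ∈ halfBall (0 : Space m) 1
    · rw [indicator_of_mem hx, indicator_of_mem (hiff.1 hx)]
    · rw [indicator_of_notMem hx, indicator_of_notMem (fun h => hx (hiff.2 h))]
  simp_rw [h2]
  rw [h1]
  simp
  field_simp

/-- The Weiss energy in terms of the frequency. -/
theorem weiss_transl (hx₀ : x₀ ∈ flatBall 0 1) {r : ℝ} (hr : r ∈ Ioo (0 : ℝ) 1)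
    (hne : frequency u x₀ r ≠ 0) :
    weiss (transl u x₀) (translGrad u x₀) r =
      (∫ ω in hemi m, resc (transl u x₀) r ω * resc (transl u x₀) r ω ∂(sph m)) *
        (frequency u x₀ r - 3 / 2) := by
  have hr0 := hr.1
  set I : ℝ := ∫ x in halfBall (0 : Space m) 1,
    inner ℝ (translGrad u x₀ (r • x)) (translGrad u x₀ (r • x))
  set H : ℝ := ∫ ω in hemi m, u (x₀ + r • (ω : Space m)) ^ 2 ∂(sph m)
  have e1 : ∫ x in halfBall (0 : Space m) 1, inner ℝ (rescGrad (translGrad u x₀) r x)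
      (rescGrad (translGrad u x₀) r x) = r⁻¹ * I := by
    rw [← integral_const_mul]
    congr 1
    funext x
    simp only [rescGrad, inner_smul_left, inner_smul_right, conj_trivial, ← mul_assoc]
    rw [← Real.rpow_add hr0]
    norm_num [Real.rpow_neg_one]
  have e2 : ∫ ω in hemi m, resc (transl u x₀) r ω * resc (transl u x₀) r ω ∂(sph m) =
      (r ^ 3)⁻¹ * H := by
    rw [← integral_const_mul]
    congr 1
    funext ω
    have : r ^ (-(3 / 2) : ℝ) * r ^ (-(3 / 2) : ℝ) = (r ^ 3)⁻¹ := by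
      rw [← Real.rpow_add hr0, show (-(3 / 2) + -(3 / 2) : ℝ) = -(3 : ℕ) by norm_num,
        Real.rpow_neg hr0.le, Real.rpow_natCast]
    rw [← this]
    simp only [resc, transl]
    ring
  have e3 : ∫ x in halfBall x₀ r, ‖gradient u x‖ ^ 2 = r ^ (m + 2) * I := by
    rw [setIntegral_halfBall_scale hx₀.2 hr0]
    congr 1
    refine setIntegral_congr_fun (isOpen_halfBall _ _).measurableSet fun x hx => ?_
    have : gradient u (x₀ + r • x) = translGrad u x₀ (r • x) := by
      rw [translGrad, D_eq_fderiv u (add_mem_halfBall_two hx₀ (smul_mem_halfBall hr hx)), gradient]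
    simp only [this, real_inner_self_eq_norm_sq]
  have e4 : frequency u x₀ r = (r * (r ^ (m + 2) * I)) / (r ^ (m + 1) * H) := by
    rw [frequency, e3, hemiIntegral_eq]
  -- Division by zero returns 0, so a nonzero frequency forces a nonzero denominator.
  have hH : H ≠ 0 := by
    intro hH
    rw [e4, hH, mul_zero, div_zero] at hne
    exact hne rfl
  rw [weiss, e1, e2, e4]
  field_simp
  ring

/-- The rescalings are bounded by K on the half sphere, so the factor in front of the frequency
minus 3/2 stays bounded, while the frequency tends to 3/2. -/
theorem StandingAssumptions.tendsto_weiss (h : StandingAssumptions α u f)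
    (hx₀ : x₀ ∈ freeBoundary u ∩ flatBall 0 1) {K : ℝ≥0} (hK : HalfBallBound u x₀ K) :
    Tendsto (weiss (transl u x₀) (translGrad u x₀)) (𝓝[>] 0) (𝓝 0) := by
  have hreg : Tendsto (frequency u x₀) (𝓝[>] 0) (𝓝 (3 / 2)) := (h.all_regular ▸ hx₀.1 :).2
  have hS := sigData_transl h.solution h.u_mem hx₀.2
  set S := (sph m).real (hemi m)
  have hne : ∀ᶠ r in 𝓝[>] (0 : ℝ), frequency u x₀ r ≠ 0 :=
    hreg.eventually_ne (by norm_num)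
  have hI : ∀ᶠ r in 𝓝[>] (0 : ℝ), r ∈ Ioo (0 : ℝ) 1 := Ioo_mem_nhdsGT zero_lt_one
  have hlim : Tendsto (fun r => (K : ℝ) * K * S * |frequency u x₀ r - 3 / 2|) (𝓝[>] 0) (𝓝 0) := by
    have := ((hreg.sub_const (3 / 2)).abs).const_mul ((K : ℝ) * K * S)
    simpa using this
  refine squeeze_zero_norm' ?_ hlim
  filter_upwards [hne, hI] with r hr1 hr2
  rw [weiss_transl hx₀.2 hr2 hr1, norm_mul, Real.norm_eq_abs (frequency u x₀ r - 3 / 2)]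
  refine mul_le_mul_of_nonneg_right ?_ (abs_nonneg _)
  refine norm_setIntegral_le_of_norm_le_const (measure_lt_top _ _) fun ω hω => ?_
  have hb : ‖resc (transl u x₀) r ω‖ ≤ K := by
    have h1 := h.abs_transl_le hx₀ hK hr2.1 hr2.2 (mapsTo_hemi hr2.1.le le_rfl hω)
    rw [resc, norm_mul, Real.norm_of_nonneg (Real.rpow_nonneg hr2.1.le _), Real.norm_eq_abs]
    calc r ^ (-(3 / 2) : ℝ) * |transl u x₀ (r • (ω : Space m))|
        ≤ r ^ (-(3 / 2) : ℝ) * (K * r ^ (3 / 2 : ℝ)) :=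
          mul_le_mul_of_nonneg_left h1 (Real.rpow_nonneg hr2.1.le _)
      _ = K * (r ^ (-(3 / 2) : ℝ) * r ^ (3 / 2 : ℝ)) := by ring
      _ = K := by rw [← Real.rpow_add hr2.1]; norm_num
  rw [norm_mul]
  exact mul_le_mul hb hb (norm_nonneg _) K.2

theorem profile_add (f : EuclideanSpace ℝ (Fin m) → ℝ) (h0 : x₀ (idxN m) = 0) (x : Space m) :
    profile f x₀ (x₀ + x) = prof (outerNormal f x₀) x := by
  rw [profile, prof, zmap_apply]
  simp [h0]

/-- The surface scaling leaves r^(m+1) / r^(m+4) = r^(-3), that is r^(-3/2) for each factor of the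
square. The profile absorbs it by homogeneity. -/
theorem monneau_eq (f : EuclideanSpace ℝ (Fin m) → ℝ) (u : Space m → ℝ) (c₀ : ℝ)
    (h0 : x₀ (idxN m) = 0) {r : ℝ} (hr : 0 < r) :
    monneau f x₀ r u c₀ =
      ∫ ω in hemi m, (resc (transl u x₀) r ω - c₀ * prof (outerNormal f x₀) ω) ^ 2 ∂(sph m) := by
  rw [monneau, hemiIntegral_eq, ← mul_assoc, ← integral_const_mul]
  congr 1
  funext ω
  have e1 : 1 / r ^ (m + 4) * r ^ (m + 1) = r ^ (-(3 / 2) : ℝ) * r ^ (-(3 / 2) : ℝ) := by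
    rw [← Real.rpow_add hr, show (-(3 / 2) + -(3 / 2) : ℝ) = -(3 : ℕ) by norm_num,
      Real.rpow_neg hr.le, Real.rpow_natCast]
    field_simp
    ring
  have e2 : r ^ (-(3 / 2) : ℝ) * r ^ (3 / 2 : ℝ) = 1 := by
    rw [← Real.rpow_add hr]; norm_num
  rw [profile_add f h0, prof_smul _ _ hr, e1]
  simp only [resc, transl]
  linear_combination (c₀ ^ 2 * prof (outerNormal f x₀) ω ^ 2 *
    (r ^ (-(3 / 2) : ℝ) * r ^ (3 / 2 : ℝ) + 1) - 2 * c₀ * prof (outerNormal f x₀) ω *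
    u (x₀ + r • (ω : Space m)) * r ^ (-(3 / 2) : ℝ)) * e2

end

end Signorini

end

/-! ### The main theorem -/

theorem mainTheorem6 (m : ℕ) (hm : 1 ≤ m) (α : ℝ≥0) (hα0 : 0 < α) (hα1 : α ≤ 1) :
    -- a bound for the half-ball norms always exists, locally uniformly in the centre
    (∀ (u : Signorini.Space m → ℝ) (f : EuclideanSpace ℝ (Fin m) → ℝ),
      Signorini.StandingAssumptions α u f →
      ∀ ρ : ℝ, ρ < 1 → ∃ Cu : ℝ≥0,
        ∀ x₀ ∈ Signorini.freeBoundary u ∩ Signorini.flatBall 0 ρ,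
          Signorini.HalfBallBound u x₀ Cu) ∧
    -- the monotonicity, with a constant depending on the listed quantities only
    (∀ (L Cu : ℝ≥0) (c₀ : ℝ), 0 < c₀ → ∃ Ct : ℝ,
      ∀ (u : Signorini.Space m → ℝ) (f : EuclideanSpace ℝ (Fin m) → ℝ),
        Signorini.StandingAssumptions α u f →
        Signorini.c1HolderNorm α f (Metric.closedBall 0 2) ≤ L →
        ∀ x₀ ∈ Signorini.freeBoundary u ∩ Signorini.flatBall 0 1,
          Signorini.HalfBallBound u x₀ Cu →
          MonotoneOn (fun r : ℝ => Signorini.monneau f x₀ r u c₀ + Ct * r ^ (α : ℝ))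
            (Ioo 0 1)) := by
  open Signorini in
  refine ⟨fun u f h ρ hρ => ?_, fun L Cu c₀ hc₀ => ?_⟩
  · obtain ⟨Cu, hCu⟩ := h.u_mem.exists_halfBallBound hρ
    exact ⟨Cu, fun x₀ hx₀ => hCu x₀ hx₀.2⟩
  obtain ⟨A₀, hA0, hA⟩ := exists_const_monotone m
  -- Here κ = 3 Cu (1 + L) is the growth constant 2 Cu (1 + L) times the bound 3/2 for |∂_n p| on
  -- the flat disc.
  refine ⟨2 * c₀ * (3 * Cu * (1 + L)) * A₀ / α, fun u f h hL x₀ hx₀ hK => ?_⟩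
  have h0 : x₀ (idxN m) = 0 := hx₀.2.2
  have hν := norm_outerNormal f x₀
  have hνn := outerNormal_last f x₀
  have hS := sigData_transl h.solution h.u_mem hx₀.2
  have hmono := hA (transl u x₀) (translGrad u x₀) (prof (outerNormal f x₀))
    (profGrad (outerNormal f x₀)) c₀ (3 * Cu * (1 + L)) α hS (harmPair_prof hν hνn)
    (fun ω _ => inner_profGrad _ _) (fun x _ hn => prof_flat_nonneg _ hn)
    (h.tendsto_weiss hx₀ hK) hc₀.le (by positivity) (by exact_mod_cast hα0) (fun r hr x hx hn => by
      have hnn := hS.resc_nonneg hr hx hn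
      have hrα : (0 : ℝ) ≤ 3 * Cu * (1 + L) * r ^ (α : ℝ) :=
        mul_nonneg (by positivity) (Real.rpow_nonneg hr.1.le _)
      -- On the side x·ν ≥ 0 the normal derivative of the profile vanishes; on the other side the
      -- solution is of higher order.
      rcases le_or_gt 0 (inner ℝ x (outerNormal f x₀)) with hin | hin
      · rw [profGrad_flat_of_nonneg hνn hn hin, mul_zero]
        linarith
      have hq := profGrad_flat_ge hν hνn hn hx.1
      have hle := h.transl_le_of_inner_neg hα0 hα1 hL hx₀ hK hr (x := r • x)
        (by simpa using smul_mem_closedHalf hr.1.le hx) (by simp [hn])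
        (by rw [inner_smul_left]; exact mul_neg_of_pos_of_neg hr.1 hin)
      have hresc : resc (transl u x₀) r x ≤ 2 * Cu * (1 + L) * r ^ (α : ℝ) := by
        calc resc (transl u x₀) r x
            ≤ r ^ (-(3 / 2) : ℝ) * (2 * Cu * (1 + L) * r ^ (3 / 2 + α : ℝ)) :=
              mul_le_mul_of_nonneg_left hle (Real.rpow_nonneg hr.1.le _)
          _ = 2 * Cu * (1 + L) * (r ^ (-(3 / 2) : ℝ) * r ^ (3 / 2 + α : ℝ)) := by ring
          _ = 2 * Cu * (1 + L) * r ^ (α : ℝ) := by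
              rw [← Real.rpow_add hr.1]; congr 2; ring
      have := mul_le_mul_of_nonneg_left hq hnn
      linarith)
  refine hmono.congr fun r hr => ?_
  simp only [monneau_eq f u c₀ h0 hr.1]
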